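/- Let $K$ be a number field. Let $X_0$ be a geometrically integral proper curve over $K$ with a single node, whose two tangent directions are defined over $K$, let $C$ be the normalization of $X_0$ and let $p\neq q\in C(K)$ be the two points above the node. Let $\pi\colon X\to S$ be a proper flat family of curves over $K$ smoothing $X_0$: here $S$ is an integral smooth (quasi-projective) curve over $K$ with a base point $0\in S(K)$, $X$ is smooth over $K$ of dimension two, the generic fibre of $\pi$ is smooth, and $\pi^{-1}(0)=X_0$. Let $\kappa\colon\Omega_{S,0}\to\Omega_{C,p}\otimes_K\Omega_{C,q}$ be the small Kodaira–Spencer map: if $t$ is a coordinate of $S$ at $0$ and $a,b$ are formal coordinates of $X$ at the node with $t=ab$, restricting to local coordinates of $C$ at $p$ and at $q$ respectively, then $\kappa(\mathrm dt|_0)=\mathrm da|_p\otimes\mathrm db|_q$. Fix a nonzero $\chi\in\Omega_{S,0}$. Let $\mathcal C$ be a proper regular flat model of $C$ over $\mathcal O_K$, let $\overline p,\overline q$ be the Zariski closures of $p,q$ on $\mathcal C$, and let $\Phi$ be a $\mathbb Q$-divisor on $\mathcal C$, supported on closed fibres, such that $\overline p-\overline q+\Phi$ has degree zero on every irreducible component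 of every closed fibre of $\mathcal C/\mathcal O_K$. For a finite prime $\mathfrak p$ of $K$ let $\iota_{\mathfrak p}$ be the intersection multiplicity above $\mathfrak p$ on $\mathcal C$ (the sum over the closed points $z$ above $\mathfrak p$ of the local intersection multiplicities at $z$, weighted by the residue degrees $[\kappa(z):\kappa(\mathfrak p)]$), let $\mathrm N\mathfrak p$ be the norm of $\mathfrak p$, and let $\mathbb C_{\mathfrak p}$ be the completion of an algebraic closure of $K_{\mathfrak p}$ with the absolute value $|\cdot|_{\mathfrak p}$ normalised by $|\varpi|_{\mathfrak p}^{-1}=\mathrm N\mathfrak p$ for a uniformizer $\varpi$ of $\mathfrak p$. Let $\operatorname{val}_{\mathfrak p}\chi$ be the largest integer $n$ such that $\kappa(\chi)$ lies in $\mathfrak p^n(\Omega_{\mathcal C/\mathcal O_K,\overline p}\otimes\Omega_{\mathcal C/\mathcal O_K,\overline q})$ after localizing at $\mathfrak p$, where $\Omega_{\mathcal C/\mathcal O_K,\overline p}\subset\Omega_{C,p}$ is the lattice given by the pull-back of $\Omega_{\mathcal C/\mathcal O_K}$ along the section $\overline p$ (and likewise for $q$). For $p',q'\in C(\mathbb C_{\mathfrak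 p})\setminus\{p,q\}$ the local Néron pairing is $\langle p'-q',p-q\rangle_{\mathfrak p}=-\iota_{\mathfrak p}(\overline{p}'-\overline{q}',\mathcal E)\log\mathrm N\mathfrak p$, where $\mathcal E$ is any $\mathbb Q$-divisor on $\mathcal C$ that extends $p-q$ and has degree zero on every component of the fibre above $\mathfrak p$, and where $\iota_{\mathfrak p}(\overline x,\mathcal E)$, for $x\in C(\mathbb C_{\mathfrak p})$, is the valuation (normalised by $\operatorname{val}(\varpi)=1$) of the pull-back of a local equation of $\mathcal E$ along the point $\overline x\in\mathcal C(\mathcal O_{\mathbb C_{\mathfrak p}})$ extending $x$. The regularized pairing is $$\langle p-q,p-q\rangle_{\kappa(\chi),\mathfrak p}=\lim_{p',q'\to p,q}\bigl(\langle p'-q',p-q\rangle_{\mathfrak p}-\log|u(p')v(q')|_{\mathfrak p}\bigr),$$ where $p'\neq p$ and $q'\neq q$ approach $p$ and $q$ in $C(\mathbb C_{\mathfrak p})$, and where $u,v\in K(C)$ are any rational functions, regular at $p$ and at $q$ respectively, with $u(p)=v(q)=0$ and $\mathrm du|_p\otimes\mathrm dv|_q=\kappa(\chi)$. Then, for every finite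 prime $\mathfrak p$ of $K$, this limit exists for every choice of $u,v$, and $$\langle p-q,p-q\rangle_{\kappa(\chi),\mathfrak p}=\bigl(\operatorname{val}_{\mathfrak p}\chi+2\,\iota_{\mathfrak p}(\overline p,\overline q)-\iota_{\mathfrak p}(\overline p-\overline q,\Phi)\bigr)\log\mathrm N\mathfrak p .$$ -/

import Mathlib

open AlgebraicGeometry CategoryTheory IsLocalRing IsDedekindDomain
open scoped NumberField TensorProduct Topology NNReal

universe u

noncomputable section

namespace NeronLimit

/-! ### The field `ℂ_𝔭` -/

section Cp

variable (K : Type u) [Field K] [NumberField K] (𝔭 : HeightOneSpectrum (𝓞 K))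

/-- The norm on the completion `K_𝔭` is the one of Mathlib, normalised by `‖π‖⁻¹ = N𝔭`. -/
instance : NontriviallyNormedField (𝔭.adicCompletion K) where
  non_trivial := by
    obtain ⟨x, hx0, hx⟩ := Submodule.exists_mem_ne_zero_of_ne_bot 𝔭.ne_bot
    have h1 : ‖NumberField.FinitePlace.embedding 𝔭 (algebraMap (𝓞 K) K x)‖ < 1 :=
      (NumberField.FinitePlace.norm_lt_one_iff_mem K 𝔭 x).2 hx0
    refine ⟨(NumberField.FinitePlace.embedding 𝔭 (algebraMap (𝓞 K) K x))⁻¹, ?_⟩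
    rw [norm_inv]
    refine (one_lt_inv₀ ?_).2 h1
    rw [norm_pos_iff, map_ne_zero]
    exact fun h => hx ((FaithfulSMul.algebraMap_eq_zero_iff (𝓞 K) K).1 h)

/-- An algebraic closure of `K_𝔭`. -/
def AlgCl : Type u := AlgebraicClosure (𝔭.adicCompletion K)

instance : Field (AlgCl K 𝔭) := inferInstanceAs (Field (AlgebraicClosure (𝔭.adicCompletion K)))

instance : Algebra (𝔭.adicCompletion K) (AlgCl K 𝔭) :=
  inferInstanceAs (Algebra (𝔭.adicCompletion K) (AlgebraicClosure (𝔭.adicCompletion K)))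

instance : Algebra.IsAlgebraic (𝔭.adicCompletion K) (AlgCl K 𝔭) :=
  inferInstanceAs (Algebra.IsAlgebraic (𝔭.adicCompletion K)
    (AlgebraicClosure (𝔭.adicCompletion K)))

instance : IsAlgClosed (AlgCl K 𝔭) :=
  inferInstanceAs (IsAlgClosed (AlgebraicClosure (𝔭.adicCompletion K)))

/-- The unique extension of the absolute value of `K_𝔭` to its algebraic closure. -/
instance : NormedField (AlgCl K 𝔭) := spectralNorm.normedField (𝔭.adicCompletion K) (AlgCl K 𝔭)

instance : IsUltrametricDist (AlgCl K 𝔭) :=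
  IsUltrametricDist.isUltrametricDist_of_forall_norm_add_le_max_norm
    (isNonarchimedean_spectralNorm (K := 𝔭.adicCompletion K) (L := AlgCl K 𝔭))

/-- The field `ℂ_𝔭`: the completion of an algebraic closure of `K_𝔭`. -/
def Cp : Type u := UniformSpace.Completion (AlgCl K 𝔭)

instance : NormedField (Cp K 𝔭) :=
  inferInstanceAs (NormedField (UniformSpace.Completion (AlgCl K 𝔭)))

instance : CompleteSpace (Cp K 𝔭) :=
  inferInstanceAs (CompleteSpace (UniformSpace.Completion (AlgCl K 𝔭)))

instance : IsUltrametricDist (Cp K 𝔭) where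
  dist_triangle_max x y z := by
    refine UniformSpace.Completion.induction_on₃ (α := AlgCl K 𝔭) (β := AlgCl K 𝔭)
      (γ := AlgCl K 𝔭)
      (p := fun x y z => dist x z ≤ max (dist x y) (dist y z)) x y z ?_ ?_
    · exact isClosed_le (by fun_prop) (by fun_prop)
    · intro a b c
      simp only [UniformSpace.Completion.dist_eq]
      exact dist_triangle_max a b c

/-- The embedding `K → K_𝔭 → ℂ_𝔭`. -/
def toCp : K →+* Cp K 𝔭 :=
  (UniformSpace.Completion.coeRingHom (α := AlgCl K 𝔭)).comp
    ((algebraMap (𝔭.adicCompletion K) (AlgCl K 𝔭)).comp (NumberField.FinitePlace.embedding 𝔭))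

/-- The absolute value of `ℂ_𝔭` restricts to `x ↦ (N𝔭)^(-v_𝔭(x))` on `K`. -/
theorem norm_toCp (x : K) : ‖toCp K 𝔭 x‖ = NumberField.HeightOneSpectrum.adicAbv K 𝔭 x := by
  rw [← NumberField.FinitePlace.norm_embedding]
  have h1 : ‖toCp K 𝔭 x‖ = ‖algebraMap (𝔭.adicCompletion K) (AlgCl K 𝔭)
      (NumberField.FinitePlace.embedding 𝔭 x)‖ :=
    UniformSpace.Completion.norm_coe (E := AlgCl K 𝔭) _
  rw [h1]
  exact spectralNorm_extends (K := 𝔭.adicCompletion K) (L := AlgCl K 𝔭) _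

theorem norm_toCp_le_one (a : 𝓞 K) : ‖toCp K 𝔭 (algebraMap (𝓞 K) K a)‖ ≤ 1 := by
  rw [norm_toCp, ← NumberField.FinitePlace.norm_embedding]
  exact NumberField.FinitePlace.norm_le_one K 𝔭 a

end Cp

/-! ### Points of a curve with values in a valued field -/

section Points

variable {K : Type u} [Field K] {C : Scheme.{u}}

/-- The point of the topological space underlying an `R`-valued point of `C`, `R` a local ring:
the image of the closed point of `Spec R`. -/
def pt {R : Type u} [CommRing R] [IsLocalRing R] (x : Spec (.of R) ⟶ C) : C :=
  x (closedPoint R)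

/-- `C(L)`, for a `K`-scheme `c : C ⟶ Spec K` and a field extension `φ : K → L`. -/
def Points (c : C ⟶ Spec (.of K)) {L : Type u} [Field L] (φ : K →+* L) : Type u :=
  {x : Spec (.of L) ⟶ C // x ≫ c = Spec.map (CommRingCat.ofHom φ)}

/-- `C(K)`. -/
abbrev KPoints (c : C ⟶ Spec (.of K)) : Type u := {x : Spec (.of K) ⟶ C // x ≫ c = 𝟙 _}

/-- The map `C(K) → C(L)`. -/
def KPoints.toPoints {c : C ⟶ Spec (.of K)} (x : KPoints c) {L : Type u} [Field L]
    (φ : K →+* L) : Points c φ :=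
  ⟨Spec.map (CommRingCat.ofHom φ) ≫ x.1, by rw [Category.assoc, x.2, Category.comp_id]⟩

open Classical in
/-- The value `g(x) ∈ L` of a function `g` regular on the open set `U` at an `L`-valued point `x`
of `U` (and `0` if `x` does not lie in `U`). -/
def evalAt {L : Type u} [Field L] (x : Spec (.of L) ⟶ C) {U : C.Opens} (g : Γ(C, U)) : L :=
  if h : x (closedPoint L) ∈ U then
    (Scheme.stalkClosedPointTo x).hom ((C.presheaf.germ U _ h).hom g) else 0

/-- The analytic topology on `C(L)`: the coarsest one for which, for every Zariski open `U`, the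
set `U(L)` is open and every regular function on `U` is continuous on `U(L)`. -/
instance {c : C ⟶ Spec (.of K)} {L : Type u} [NormedField L] {φ : K →+* L} :
    TopologicalSpace (Points c φ) :=
  TopologicalSpace.generateFrom
    {V | ∃ (U : C.Opens) (g : Γ(C, U)) (W : Set L), IsOpen W ∧
      V = {x : Points c φ | pt x.1 ∈ U ∧ evalAt x.1 g ∈ W}}

end Points

/-! ### Cotangent spaces -/

section Cotangent

/-- The pull-back map on germs `𝒪_{Y,z} → 𝒪_{X,x}` of a morphism `g : X ⟶ Y`, for a point `z` in
the closure of `g x` (usually `z = g x`). -/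
def germMap {X Y : Scheme.{u}} (g : X ⟶ Y) {x : X} {z : Y} (h : g x ⤳ z) :
    Y.presheaf.stalk z →+* X.presheaf.stalk x :=
  (g.stalkMap x).hom.comp (Y.presheaf.stalkSpecializes h).hom

/-- The fibre `Ω_{C,x} = 𝔪_x / 𝔪_x²` at the point `x` of a `K`-scheme `c : C ⟶ Spec K` (only used
at `K`-rational points). -/
def Cot {K : Type u} [Field K] {C : Scheme.{u}} (_c : C ⟶ Spec (.of K)) (x : C) : Type u :=
  CotangentSpace (C.presheaf.stalk x)

variable {K : Type u} [Field K] {C : Scheme.{u}} (c : C ⟶ Spec (.of K)) (x : C)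

/-- The structure map `K → 𝒪_{C,x}`. -/
def scalars : K →+* C.presheaf.stalk x :=
  (C.presheaf.germ ⊤ x trivial).hom.comp
    (c.appTop.hom.comp (Scheme.ΓSpecIso (.of K)).inv.hom)

instance : AddCommGroup (Cot c x) :=
  inferInstanceAs (AddCommGroup (CotangentSpace (C.presheaf.stalk x)))

instance : Module (C.presheaf.stalk x) (Cot c x) :=
  inferInstanceAs (Module (C.presheaf.stalk x) (CotangentSpace (C.presheaf.stalk x)))

instance : Module K (Cot c x) := Module.compHom _ (scalars c x)

open Classical in
/-- The differential `df|_x ∈ Ω_{C,x}` of a germ `f` vanishing at `x` (and `0` if `f(x) ≠ 0`). -/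
def differential (f : C.presheaf.stalk x) : Cot c x :=
  if h : f ∈ maximalIdeal (C.presheaf.stalk x) then (maximalIdeal _).toCotangent ⟨f, h⟩ else 0

end Cotangent

/-! ### Smoothings of a nodal curve and the small Kodaira--Spencer map -/

/-- A local ring is a *split node* if its completion is isomorphic to `k[[a,b]]/(ab)`. -/
def IsSplitNode (k : Type u) [Field k] (R : Type u) [CommRing R] [IsLocalRing R] : Prop :=
  Nonempty (AdicCompletion (maximalIdeal R) R ≃+*
    (MvPowerSeries (Fin 2) k ⧸ Ideal.span
      {(MvPowerSeries.X 0 * MvPowerSeries.X 1 : MvPowerSeries (Fin 2) k)}))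

/-- A family `π : X ⟶ S` over a field `K` smoothing a geometrically integral proper curve `X₀` with
a single node (whose tangent directions are defined over `K`), together with the normalization `C`
of `X₀` and the two points `p`, `q` of `C` above the node. -/
structure NodalSmoothing (K : Type u) [Field K] where
  /-- the base curve -/
  S : Scheme.{u}
  /-- the total space -/
  X : Scheme.{u}
  /-- the structure morphism of the base -/
  toK : S ⟶ Spec (.of K)
  integral_base : IsIntegral S
  smooth_base : SmoothOfRelativeDimension 1 toK
  separated_base : IsSeparated toK
  quasiCompact_base : QuasiCompact toK
  /-- the family -/
  π : X ⟶ S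
  proper : IsProper π
  flat : Flat π
  smooth_total : SmoothOfRelativeDimension 2 (π ≫ toK)
  smooth_generic : ∃ V : S.Opens, (V : Set S).Nonempty ∧ Smooth (π ∣_ V)
  /-- the base point `0 ∈ S(K)` -/
  zero : KPoints toK
  /-- the special fibre -/
  X₀ : Scheme.{u}
  /-- the inclusion of the special fibre -/
  ι : X₀ ⟶ X
  /-- the structure morphism of the special fibre -/
  X₀toK : X₀ ⟶ Spec (.of K)
  isPullback : IsPullback ι X₀toK π zero.1
  geometricallyIntegral : GeometricallyIntegral X₀toK
  /-- the normalization of the special fibre -/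
  C : Scheme.{u}
  /-- the normalization morphism -/
  ν : C ⟶ X₀
  finite_ν : IsFinite ν
  geometricallyIntegral_C : GeometricallyIntegral (ν ≫ X₀toK)
  smooth_C : SmoothOfRelativeDimension 1 (ν ≫ X₀toK)
  /-- the first point above the node -/
  p : KPoints (ν ≫ X₀toK)
  /-- the second point above the node -/
  q : KPoints (ν ≫ X₀toK)
  p_ne_q : pt p.1 ≠ pt q.1
  fiber_node : ∀ y : C, ν y = ν (pt p.1) ↔ y = pt p.1 ∨ y = pt q.1
  isIso_away : ∀ U : X₀.Opens, (U : Set X₀) = {ν (pt p.1)}ᶜ → IsIso (ν ∣_ U)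
  node : IsSplitNode K (X₀.presheaf.stalk (ν (pt p.1)))

namespace NodalSmoothing

variable {K : Type u} [Field K] (F : NodalSmoothing K)

/-- The curve `C` as a `K`-scheme. -/
abbrev c : F.C ⟶ Spec (.of K) := F.ν ≫ F.X₀toK

/-- The map `C → X₀ → X`. -/
abbrev toX : F.C ⟶ F.X := F.ν ≫ F.ι

/-- The node, as a point of `X`. -/
def nodePt : F.X := F.toX (pt F.p.1)

theorem toX_p : F.toX (pt F.p.1) ⤳ F.nodePt := specializes_rfl

theorem toX_q : F.toX (pt F.q.1) ⤳ F.nodePt := by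
  have h : F.ν (pt F.q.1) = F.ν (pt F.p.1) := (F.fiber_node _).2 (Or.inr rfl)
  refine specializes_of_eq ?_
  simp [nodePt, toX, h]

theorem π_nodePt : F.π F.nodePt ⤳ pt F.zero.1 := by
  refine specializes_of_eq ?_
  have h : F.π (F.ι (F.ν (pt F.p.1))) = F.zero.1 (F.X₀toK (F.ν (pt F.p.1))) := by
    rw [← Scheme.Hom.comp_apply, F.isPullback.w, Scheme.Hom.comp_apply]
  have h2 : F.X₀toK (F.ν (pt F.p.1)) = closedPoint K := Subsingleton.elim _ _
  rw [h2] at h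
  simpa only [nodePt, toX, Scheme.Hom.comp_apply] using! h

/-- The graph of the small Kodaira--Spencer map `κ : Ω_{S,0} → Ω_{C,p} ⊗ Ω_{C,q}`.
One has `κ(χ) = ξ` if there are a coordinate `t` of `S` at `0` with `dt|_0 = χ` and formal
coordinates `a`, `b` of `X` at the node with `t = ab`, restricting to local coordinates of `C`
at `p` and at `q` respectively, such that `ξ = da|_p ⊗ db|_q`. The germs `a₁`, `b₁` are
approximations of `a`, `b` modulo the square of the maximal ideal, which suffices to compute the
differentials. -/
def IsKodairaSpencer (χ : Cot F.toK (pt F.zero.1))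
    (ξ : Cot F.c (pt F.p.1) ⊗[K] Cot F.c (pt F.q.1)) : Prop :=
  ∃ t ∈ maximalIdeal (F.S.presheaf.stalk (pt F.zero.1)), differential F.toK _ t = χ ∧
  ∃ a b : AdicCompletion (maximalIdeal (F.X.presheaf.stalk F.nodePt))
      (F.X.presheaf.stalk F.nodePt),
    Ideal.span {a, b} = (maximalIdeal (F.X.presheaf.stalk F.nodePt)).map (algebraMap _ _) ∧
    a * b = algebraMap _ _ (germMap F.π F.π_nodePt t) ∧
  ∃ a₁ ∈ maximalIdeal (F.X.presheaf.stalk F.nodePt),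
  ∃ b₁ ∈ maximalIdeal (F.X.presheaf.stalk F.nodePt),
    AdicCompletion.evalₐ _ 2 a = Ideal.Quotient.mk _ a₁ ∧
    AdicCompletion.evalₐ _ 2 b = Ideal.Quotient.mk _ b₁ ∧
    differential F.c _ (germMap F.toX F.toX_p a₁) ≠ 0 ∧
    differential F.c _ (germMap F.toX F.toX_q b₁) ≠ 0 ∧
    ξ = differential F.c _ (germMap F.toX F.toX_p a₁) ⊗ₜ[K]
      differential F.c _ (germMap F.toX F.toX_q b₁)

end NodalSmoothing

/-! ### Regular models and intersection numbers -/

/-- The closed point of `Spec 𝓞_K` given by a finite prime `𝔭`. -/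
def primePt {K : Type u} [Field K] [NumberField K] (𝔭 : HeightOneSpectrum (𝓞 K)) :
    Spec (.of (𝓞 K)) :=
  (⟨𝔭.asIdeal, 𝔭.isPrime⟩ : PrimeSpectrum (𝓞 K))

/-- A proper regular flat model over `𝓞_K` of a curve `c : C ⟶ Spec K`. -/
structure RegularModel {K : Type u} [Field K] [NumberField K] {C : Scheme.{u}}
    (c : C ⟶ Spec (.of K)) where
  /-- the model -/
  X : Scheme.{u}
  /-- its structure morphism -/
  f : X ⟶ Spec (.of (𝓞 K))
  /-- the inclusion of the generic fibre -/
  j : C ⟶ X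
  isIntegral : IsIntegral X
  isProper : IsProper f
  flat : Flat f
  regular : ∀ z : X, IsRegularLocalRing (X.presheaf.stalk z)
  isPullback : IsPullback j c f (Spec.map (CommRingCat.ofHom (algebraMap (𝓞 K) K)))

namespace RegularModel

variable {K : Type u} [Field K] [NumberField K] {C : Scheme.{u}} {c : C ⟶ Spec (.of K)}
  (M : RegularModel c) (𝔭 : HeightOneSpectrum (𝓞 K))

open Classical in
/-- The ideal in `𝒪_{M,z}` of the integral closed subscheme with generic point `y` (the unit ideal
if `z` does not lie on it). -/
def idealAt (y z : M.X) : Ideal (M.X.presheaf.stalk z) :=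
  if h : y ⤳ z then (maximalIdeal (M.X.presheaf.stalk y)).comap
    (M.X.presheaf.stalkSpecializes h).hom else ⊤

/-- The local intersection multiplicity at `z` of two distinct prime divisors with generic points
`y` and `w`: the length of `𝒪_z / (I_y + I_w)`. -/
def localInt (y w z : M.X) : ℕ :=
  (Module.length (M.X.presheaf.stalk z)
    (M.X.presheaf.stalk z ⧸ (M.idealAt y z ⊔ M.idealAt w z))).toNat

/-- The intersection multiplicity above `𝔭` of two distinct prime divisors: the sum of the local
multiplicities at the points `z` above `𝔭`, weighted by the residue degrees `[κ(z) : κ(𝔭)]`. -/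
def intNum (y w : M.X) : ℚ :=
  ∑ᶠ z ∈ {z : M.X | M.f z = primePt 𝔭}, (M.localInt y w z * M.f.residueDegree z : ℚ)

/-- A `ℚ`-divisor on the model (as the model is regular, Weil and Cartier divisors agree): a finite
formal sum of points of codimension one, each of them standing for its closure. -/
def IsDivisor (D : M.X →₀ ℚ) : Prop := ∀ y ∈ D.support, Order.coheight y = 1

/-- The divisor `D` is supported on the closed fibres. -/
def IsVertical (D : M.X →₀ ℚ) : Prop :=
  M.IsDivisor D ∧ ∀ y ∈ D.support, ∃ 𝔮 : HeightOneSpectrum (𝓞 K), M.f y = primePt 𝔮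

/-- The intersection multiplicity `ι_𝔭(D, E)` of two divisors without common component,
extended bilinearly from prime divisors. -/
def intersection (D E : M.X →₀ ℚ) : ℚ :=
  D.sum fun y a => E.sum fun w b => a * b * M.intNum 𝔭 y w

/-- The (generic point of the) closure on the model of a point of the generic fibre `C`. -/
def closurePt (x : C) : M.X := M.j x

/-- The divisor `x̄` on the model, for `x ∈ C(K)`. -/
def closureDiv (x : KPoints c) : M.X →₀ ℚ := Finsupp.single (M.closurePt (pt x.1)) 1

/-- The irreducible components of the fibre above `𝔭` (given by their generic points). -/
def components : Set M.X := {V | Order.coheight V = 1 ∧ M.f V = primePt 𝔭}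

/-- The multiplicity of the component `V` in its fibre: the length of `𝒪_V / 𝔭𝒪_V`. -/
def multiplicity (V : M.X) : ℕ :=
  (Module.length (M.X.presheaf.stalk V) (M.X.presheaf.stalk V ⧸
    (maximalIdeal ((Spec (.of (𝓞 K))).presheaf.stalk (M.f V))).map (M.f.stalkMap V).hom)).toNat

open Classical in
/-- The coefficient of `w` in the divisor of the fibre above `𝔭`. -/
def fiberCoeff (w : M.X) : ℚ := if w ∈ M.components 𝔭 then M.multiplicity w else 0

open Classical in
/-- The degree (over `κ(𝔭)`) on the component `V` of the fibre above `𝔭` of the restriction of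
`𝒪(D)`, that is, the intersection number `D · V`. The fibre `F` above `𝔭` is the divisor of a
uniformizer, so `D · V = (D - rF) · V` for all `r ∈ ℚ`; we take `r` with the property that `V` is
not a component of `D - rF`. -/
def degreeOn (D : M.X →₀ ℚ) (V : M.X) : ℚ :=
  ∑ᶠ w ∈ {w : M.X | w ≠ V},
    (D w - D V / M.fiberCoeff 𝔭 V * M.fiberCoeff 𝔭 w) * M.intNum 𝔭 w V

/-- The divisor `D` has degree zero on every component of the fibre above `𝔭`. -/
def HasDegreeZero (D : M.X →₀ ℚ) : Prop := ∀ V ∈ M.components 𝔭, M.degreeOn 𝔭 D V = 0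

/-! ### The local Néron pairing -/

section Pairing

variable {L : Type u} [NormedField L] [IsUltrametricDist L] {φ : K →+* L}

variable (L) in
/-- The valuation ring of `L`. -/
abbrev intRing : ValuationSubring L := (NormedField.valuation (K := L)).valuationSubring

/-- Every `L`-valued point of `C` extends to a point of the model with values in the valuation ring
of `L`, by the valuative criterion of properness. -/
theorem exists_extension (hφ : ∀ a : 𝓞 K, ‖φ (algebraMap (𝓞 K) K a)‖ ≤ 1) (x : Points c φ) :
    ∃ s : Spec (.of (intRing L)) ⟶ M.X,
      Spec.map (CommRingCat.ofHom (algebraMap (intRing L) L)) ≫ s = x.1 ≫ M.j := by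
  let ψ : 𝓞 K →+* intRing L :=
    (φ.comp (algebraMap (𝓞 K) K)).codRestrict (intRing L) hφ
  have hsq : (x.1 ≫ M.j) ≫ M.f =
      Spec.map (CommRingCat.ofHom (algebraMap (intRing L) L)) ≫
        Spec.map (CommRingCat.ofHom ψ) := by
    rw [Category.assoc, M.isPullback.w, ← Category.assoc, x.2, ← Spec.map_comp, ← Spec.map_comp,
      ← CommRingCat.ofHom_comp, ← CommRingCat.ofHom_comp]
    rfl
  have := M.isProper
  have hex : ValuativeCriterion.Existence M.f :=
    (UniversallyClosed.eq_valuativeCriterion.le _ _ M.f inferInstance).1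
  let sq : ValuativeCommSq M.f :=
    { R := intRing L
      K := L
      i₁ := x.1 ≫ M.j
      i₂ := Spec.map (CommRingCat.ofHom ψ)
      commSq := ⟨hsq⟩ }
  obtain ⟨l, h1, -⟩ := (hex sq).exists_lift
  exact ⟨l, h1⟩

/-- The extension `x̄ : Spec 𝓞_L ⟶ M` of a point `x ∈ C(L)`. -/
def extension (hφ : ∀ a : 𝓞 K, ‖φ (algebraMap (𝓞 K) K a)‖ ≤ 1) (x : Points c φ) :
    Spec (.of (intRing L)) ⟶ M.X :=
  (M.exists_extension hφ x).choose

/-- The intersection multiplicity `ι_𝔭(x̄, y)` of a point `x ∈ C(L)` with the prime divisor with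
generic point `y`: the valuation, normalised by `val(π) = 1` for a uniformizer `π` of `𝔭`, of the
pull-back to `𝓞_L`, along `x̄`, of a local equation of the divisor. As the absolute value is at
most `1` on `𝓞_L`, its value at the pull-back of a local equation is the supremum of its values at
the pull-backs of all elements of the ideal generated by that equation. -/
def pointInt (hφ : ∀ a : 𝓞 K, ‖φ (algebraMap (𝓞 K) K a)‖ ≤ 1) (x : Points c φ) (y : M.X) : ℝ :=
  -Real.log (sSup ((fun g => ‖(((Scheme.stalkClosedPointTo (M.extension hφ x)).hom g :
      intRing L) : L)‖) '' (M.idealAt y ((M.extension hφ x) (closedPoint _)) : Set _))) /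
    Real.log (Ideal.absNorm 𝔭.asIdeal)

/-- The divisor `𝓔` on the model extends the divisor `E` on `C` and has degree zero on every
component of the fibre above `𝔭`. -/
def IsAdmissible (E : C →₀ ℤ) (𝓔 : M.X →₀ ℚ) : Prop :=
  M.IsDivisor 𝓔 ∧ (∀ x : C, 𝓔 (M.closurePt x) = E x) ∧ M.HasDegreeZero 𝔭 𝓔

open Classical in
/-- The local Néron pairing `⟨D, E⟩_𝔭 = -ι_𝔭(D̄, 𝓔) log N𝔭` of a divisor `D` of degree zero whose
components are `L`-valued points and a divisor `E` on `C` of degree zero with support disjoint from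
that of `D`. Here `𝓔` is any extension of `E` to a `ℚ`-divisor on the model that has degree zero on
every component of the fibre above `𝔭`. -/
def neronPairing (hφ : ∀ a : 𝓞 K, ‖φ (algebraMap (𝓞 K) K a)‖ ≤ 1) (D : Points c φ →₀ ℤ)
    (E : C →₀ ℤ) : ℝ :=
  if h : ∃ 𝓔, M.IsAdmissible 𝔭 E 𝓔 then
    -(D.sum fun x a => h.choose.sum fun y b => a * b * M.pointInt 𝔭 hφ x y) *
      Real.log (Ideal.absNorm 𝔭.asIdeal)
  else 0

end Pairing

/-- The divisor `p - q` on `C`. -/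
def pointDiff (p q : KPoints c) : C →₀ ℤ :=
  Finsupp.single (pt p.1) 1 - Finsupp.single (pt q.1) 1

/-- The regularized local Néron pairing `⟨p - q, p - q⟩_{ξ,𝔭}` exists and equals `r`: for all
functions `u`, `v` regular near `p`, `q` with `u(p) = v(q) = 0` and `du|_p ⊗ dv|_q = ξ`,
`⟨p' - q', p - q⟩_𝔭 - log |u(p') v(q')|_𝔭` tends to `r` as `p', q' ∈ C(ℂ_𝔭)` tend to `p`, `q`,
with `p' ≠ p` and `q' ≠ q`. -/
def IsRegularizedPairing (p q : KPoints c) (ξ : Cot c (pt p.1) ⊗[K] Cot c (pt q.1)) (r : ℝ) :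
    Prop :=
  ∀ (U V : C.Opens) (hU : pt p.1 ∈ U) (hV : pt q.1 ∈ V) (u : Γ(C, U)) (v : Γ(C, V)),
    evalAt p.1 u = 0 → evalAt q.1 v = 0 →
    differential c _ ((C.presheaf.germ U _ hU).hom u) ⊗ₜ[K]
      differential c _ ((C.presheaf.germ V _ hV).hom v) = ξ →
    Filter.Tendsto
      (fun x : Points c (toCp K 𝔭) × Points c (toCp K 𝔭) =>
        M.neronPairing 𝔭 (norm_toCp_le_one K 𝔭)
            (Finsupp.single x.1 1 - Finsupp.single x.2 1) (pointDiff p q) -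
          Real.log ‖evalAt x.1.1 u * evalAt x.2.1 v‖)
      (𝓝[≠] (p.toPoints (toCp K 𝔭)) ×ˢ 𝓝[≠] (q.toPoints (toCp K 𝔭))) (𝓝 r)

/-! ### The integral structure on cotangent vectors -/

/-- The image in `Ω_{C,x}` of the pull-back of `Ω_{M/𝓞_K}` along the section `x̄`, localized at `𝔭`.
As `x̄` is a section, this pull-back is the conormal module `I/I²` of `x̄`, so that its image
consists of the differentials at `x` of the functions on `M` which are defined near the point of
`x̄` above `𝔭` and vanish along `x̄`. -/
def cotLattice (x : C) : Set (Cot c x) :=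
  {ω | ∃ (z : M.X) (_ : M.f z = primePt 𝔭) (h : M.j x ⤳ z) (a : M.X.presheaf.stalk z),
    a ∈ M.idealAt (M.j x) z ∧ differential c x (germMap M.j h a) = ω}

/-- The lattice `Ω_{M/𝓞_K,x̄} ⊗ Ω_{M/𝓞_K,ȳ}`, localized at `𝔭`, in `Ω_{C,x} ⊗ Ω_{C,y}`. -/
def tensorLattice (x y : C) : AddSubgroup (Cot c x ⊗[K] Cot c y) :=
  AddSubgroup.closure {ζ | ∃ ω ∈ M.cotLattice 𝔭 x, ∃ η ∈ M.cotLattice 𝔭 y, ζ = ω ⊗ₜ[K] η}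

/-- The valuation at `𝔭` of `ξ ≠ 0` with respect to the lattice: the largest `n` with
`ξ ∈ 𝔭ⁿ (Ω_{M/𝓞_K,x̄} ⊗ Ω_{M/𝓞_K,ȳ})`. -/
def cotVal {x y : C} (ξ : Cot c x ⊗[K] Cot c y) : ℤ :=
  sSup {n : ℤ | ∃ a : K, 𝔭.valuation K a = WithZero.exp (-n) ∧
    ∃ ζ ∈ M.tensorLattice 𝔭 x y, ξ = a • ζ}

end RegularModel

end NeronLimit
end

/-!
Every admissible extension of `p - q` is `𝓔 = p̄ - q̄ + Ψ` with `Ψ` vertical, so the pairing of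
`p' - q'` with `p - q` is a sum of local contributions at `p` and at `q`. As `p'` tends to `p`, its
reduction is eventually constant, and the equations of a prime divisor `w ≠ p̄` have values at `p'`
whose absolute values are governed by those at `p`; hence `ι(p̄', w)` tends to `ι(p̄, w)`.

For `w = p̄`, write each generator `a` of the ideal of `p̄` as `a = u e` in the discrete valuation
ring `𝒪_{C,p}`. On the one hand `ι(p̄', p̄) log N𝔭` is `-log |u(p')|` minus the logarithm of the
largest `|e(p')|`. On the other hand the integral cotangent lattice at `p` is spanned by the
differentials `da = e(p) du`, so that the largest `|e(p)|` is `N𝔭 ^ k`, where `k` is the order of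
`du` with respect to this lattice. Thus `ι(p̄', p̄) log N𝔭 + log |u(p')|` tends to `-k log N𝔭`.

Finally `ι(p̄ - q̄, Ψ)` is the same for all vertical `Ψ` that make the degrees of `p̄ - q̄ + Ψ`
vanish, because the intersection form is symmetric on vertical divisors.
-/

noncomputable section

namespace NeronLimit

section AppLE

variable {X Y : Scheme.{u}} (f : X ⟶ Y)

theorem le_preimage_top (U : X.Opens) : U ≤ f ⁻¹ᵁ ⊤ := fun _ _ => trivial

theorem appTop_eq_appLE : f.appTop = f.appLE ⊤ ⊤ (le_preimage_top f ⊤) := by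
  rw [Scheme.Hom.appLE]
  exact ((congrArg _ (X.presheaf.map_id _)).trans (Category.comp_id _)).symm

end AppLE

section Evaluation

variable {X Y : Scheme.{u}} {R R' : Type u} [CommRing R] [IsLocalRing R] [CommRing R']
  [IsLocalRing R']

/-- Evaluation of functions regular on `U` at an `R`-valued point whose closed point lies in `U`. -/
def evalHom (x : Spec (.of R) ⟶ X) (U : X.Opens) (h : x (closedPoint R) ∈ U) : Γ(X, U) →+* R :=
  (Scheme.stalkClosedPointTo x).hom.comp (X.presheaf.germ U _ h).hom

theorem evalAt_eq_evalHom {L : Type u} [Field L] (x : Spec (.of L) ⟶ X) {U : X.Opens}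
    (h : x (closedPoint L) ∈ U) (g : Γ(X, U)) : evalAt x g = evalHom x U h g := by
  rw [evalAt, dif_pos h]
  rfl

theorem ofHom_evalHom (x : Spec (.of R) ⟶ X) {U : X.Opens} (h : x (closedPoint R) ∈ U) :
    CommRingCat.ofHom (evalHom x U h) =
      x.appLE U ⊤ (Scheme.preimage_eq_top_of_closedPoint_mem x h).ge ≫
        (Scheme.ΓSpecIso (.of R)).hom := by
  refine (Scheme.germ_stalkClosedPointTo x U h).trans ?_
  simp [Scheme.Hom.app_eq_appLE]

theorem evalHom_specMap_comp (φ : R →+* R') (x : Spec (.of R) ⟶ X) {U : X.Opens}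
    (h : x (closedPoint R) ∈ U) (h' : (Spec.map (CommRingCat.ofHom φ) ≫ x) (closedPoint R') ∈ U)
    (g : Γ(X, U)) :
    evalHom (Spec.map (CommRingCat.ofHom φ) ≫ x) U h' g = φ (evalHom x U h g) := by
  have : CommRingCat.ofHom (evalHom (Spec.map (CommRingCat.ofHom φ) ≫ x) U h') =
      CommRingCat.ofHom (evalHom x U h) ≫ CommRingCat.ofHom φ := by
    rw [ofHom_evalHom, ofHom_evalHom, Category.assoc, ← Scheme.ΓSpecIso_naturality,
      appTop_eq_appLE, Scheme.Hom.appLE_comp_appLE_assoc]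
  exact congr($(this).hom g)

theorem evalHom_comp (x : Spec (.of R) ⟶ X) (j : X ⟶ Y) {U : Y.Opens}
    (h : (x ≫ j) (closedPoint R) ∈ U) (h' : x (closedPoint R) ∈ j ⁻¹ᵁ U) (g : Γ(Y, U)) :
    evalHom (x ≫ j) U h g = evalHom x (j ⁻¹ᵁ U) h' ((j.app U).hom g) := by
  have : CommRingCat.ofHom (evalHom (x ≫ j) U h) =
      j.app U ≫ CommRingCat.ofHom (evalHom x (j ⁻¹ᵁ U) h') := by
    rw [ofHom_evalHom, ofHom_evalHom, Scheme.Hom.app_eq_appLE, Scheme.Hom.appLE_comp_appLE_assoc]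
  exact congr($(this).hom g)

theorem evalHom_congr {x y : Spec (.of R) ⟶ X} (e : x = y) {U : X.Opens}
    (h : x (closedPoint R) ∈ U) (h' : y (closedPoint R) ∈ U) (g : Γ(X, U)) :
    evalHom x U h g = evalHom y U h' g := by
  subst e
  rfl

theorem specMap_evalHom_fromSpec (x : Spec (.of R) ⟶ X) {U : X.Opens} (hU : IsAffineOpen U)
    (h : x (closedPoint R) ∈ U) :
    Spec.map (CommRingCat.ofHom (evalHom x U h)) ≫ hU.fromSpec = x := by
  have h_stalk := Scheme.Spec_stalkClosedPointTo_fromSpecStalk x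
  rwa [← hU.fromSpecStalk_eq_fromSpecStalk h, IsAffineOpen.fromSpecStalk, ← Spec.map_comp_assoc]
    at h_stalk

theorem specMap_comp_fromSpecStalk (y : Spec (.of R) ⟶ X) (j : X ⟶ Y) {z : Y}
    (h : j (y (closedPoint R)) ⤳ z) :
    Spec.map (Y.presheaf.stalkSpecializes h ≫ j.stalkMap (y (closedPoint R)) ≫
      Scheme.stalkClosedPointTo y) ≫ Y.fromSpecStalk z = y ≫ j := by
  rw [Spec.map_comp, Spec.map_comp, Category.assoc, Category.assoc,
    Scheme.SpecMap_stalkSpecializes_fromSpecStalk h, Scheme.SpecMap_stalkMap_fromSpecStalk]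
  exact Scheme.Spec_stalkClosedPointTo_fromSpecStalk_assoc y j

theorem evalAt_restrict {L : Type u} [Field L] {y : Spec (.of L) ⟶ X} {U V : X.Opens} (i : V ⟶ U)
    (hy : pt y ∈ V) (g : Γ(X, U)) : evalAt y ((X.presheaf.map i.op).hom g) = evalAt y g := by
  rw [evalAt_eq_evalHom _ hy, evalAt_eq_evalHom y (i.le hy)]
  exact congrArg (Scheme.stalkClosedPointTo y).hom (X.presheaf.germ_res_apply i _ hy g)

theorem evalAt_mul {L : Type u} [Field L] {y : Spec (.of L) ⟶ X} {U : X.Opens} (hy : pt y ∈ U)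
    (g g' : Γ(X, U)) : evalAt y (g * g') = evalAt y g * evalAt y g' := by
  rw [evalAt_eq_evalHom _ hy, evalAt_eq_evalHom _ hy, evalAt_eq_evalHom _ hy, map_mul]

theorem germMap_germ {f : X ⟶ Y} {x : X} {z : Y} (h : f x ⤳ z) {U : Y.Opens} (hz : z ∈ U)
    (g : Γ(Y, U)) :
    germMap f h ((Y.presheaf.germ U z hz).hom g) =
      (X.presheaf.germ (f ⁻¹ᵁ U) x (h.mem_open U.2 hz)).hom ((f.app U).hom g) := by
  have : Y.presheaf.germ U z hz ≫ Y.presheaf.stalkSpecializes h ≫ f.stalkMap x =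
      f.app U ≫ X.presheaf.germ (f ⁻¹ᵁ U) x (h.mem_open U.2 hz) := by
    rw [TopCat.Presheaf.germ_stalkSpecializes_assoc, Scheme.Hom.germ_stalkMap]
  exact congr($(this).hom g)

end Evaluation

section Constants

variable {X : Scheme.{u}} {B : Type u} [CommRing B] (f : X ⟶ Spec (.of B))

/-- The map from constants to sections of the structure sheaf of a scheme over an affine scheme. -/
def constants (U : X.Opens) : B →+* Γ(X, U) :=
  (f.appLE ⊤ U (le_preimage_top f U)).hom.comp (Scheme.ΓSpecIso (.of B)).inv.hom

/-- The map from constants to germs of functions on a scheme over an affine scheme. -/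
def stalkConstants (z : X) : B →+* X.presheaf.stalk z :=
  (X.presheaf.germ ⊤ z trivial).hom.comp (constants f ⊤)

theorem evalHom_constants {R : Type u} [CommRing R] [IsLocalRing R] (x : Spec (.of R) ⟶ X)
    (ψ : B →+* R) (hx : x ≫ f = Spec.map (CommRingCat.ofHom ψ)) {U : X.Opens}
    (h : x (closedPoint R) ∈ U) (b : B) : evalHom x U h (constants f U b) = ψ b := by
  have : (Scheme.ΓSpecIso (.of B)).inv ≫ f.appLE ⊤ U (le_preimage_top f U) ≫
      CommRingCat.ofHom (evalHom x U h) = CommRingCat.ofHom ψ := by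
    rw [ofHom_evalHom, Scheme.Hom.appLE_comp_appLE_assoc, hx, Iso.inv_comp_eq,
      ← Scheme.ΓSpecIso_naturality, appTop_eq_appLE]
  exact congr($(this).hom b)

theorem stalkConstants_mem_maximalIdeal_iff (z : X) (b : B) :
    stalkConstants f z b ∈ maximalIdeal (X.presheaf.stalk z) ↔
      b ∈ (show PrimeSpectrum B from f z).asIdeal := by
  have h_unit : IsUnit (stalkConstants f z b) ↔
      z ∈ X.basicOpen (f.appTop ((Scheme.ΓSpecIso (.of B)).inv b)) := by
    rw [Scheme.mem_basicOpen_top, stalkConstants, constants, Scheme.Hom.appTop,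
      Scheme.Hom.app_eq_appLE]
    rfl
  rw [mem_maximalIdeal, mem_nonunits_iff, h_unit, not_iff_comm, ← Scheme.preimage_basicOpen_top,
    basicOpen_eq_of_affine]
  exact Iff.rfl

theorem scalars_eq_stalkConstants {K : Type u} [Field K] (c : X ⟶ Spec (.of K)) (x : X) :
    scalars c x = stalkConstants c x := by
  rw [scalars, stalkConstants, constants, ← appTop_eq_appLE]

end Constants

section RationalPoint

variable {K : Type u} [Field K] {C : Scheme.{u}} {c : C ⟶ Spec (.of K)} (x : KPoints c)

/-- Evaluation of germs of functions at a rational point. -/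
def KPoints.ev : C.presheaf.stalk (pt x.1) →+* K :=
  (Scheme.stalkClosedPointTo x.1).hom

theorem KPoints.ev_germ {U : C.Opens} (h : pt x.1 ∈ U) (g : Γ(C, U)) :
    x.ev ((C.presheaf.germ U _ h).hom g) = evalAt x.1 g :=
  (evalAt_eq_evalHom x.1 h g).symm

theorem KPoints.evalHom_constants {U : C.Opens} (h : pt x.1 ∈ U) (a : K) :
    evalHom x.1 U h (constants c U a) = a :=
  NeronLimit.evalHom_constants c x.1 (RingHom.id K) (x.2.trans (Spec.map_id _).symm) h a

theorem KPoints.ev_scalars (a : K) : x.ev (scalars c (pt x.1) a) = a := by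
  rw [scalars_eq_stalkConstants]
  exact x.evalHom_constants (U := ⊤) trivial a

theorem KPoints.ev_eq_zero_iff (g : C.presheaf.stalk (pt x.1)) :
    x.ev g = 0 ↔ g ∈ maximalIdeal (C.presheaf.stalk (pt x.1)) := by
  have : IsLocalHom x.ev := Scheme.isLocalHom_stalkClosedPointTo' x.1
  rw [mem_maximalIdeal, mem_nonunits_iff, ← isUnit_map_iff x.ev, isUnit_iff_ne_zero, not_not]

variable {L : Type u} [Field L] (φ : K →+* L)

theorem pt_toPoints : pt (x.toPoints φ).1 = pt x.1 :=
  (Scheme.Hom.comp_apply _ x.1 _).trans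
    (congrArg x.1 (Subsingleton.elim (α := PrimeSpectrum K) _ _))

theorem evalAt_toPoints {U : C.Opens} (h : pt x.1 ∈ U) (g : Γ(C, U)) :
    evalAt (x.toPoints φ).1 g = φ (evalAt x.1 g) := by
  have h' : pt (x.toPoints φ).1 ∈ U := (pt_toPoints x φ).symm ▸ h
  rw [evalAt_eq_evalHom _ h', evalAt_eq_evalHom _ h]
  exact evalHom_specMap_comp φ x.1 h h' g

end RationalPoint

section Topology

variable {K : Type u} [Field K] {C : Scheme.{u}} {c : C ⟶ Spec (.of K)} {L : Type u}
  [NormedField L] {φ : K →+* L}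

theorem isOpen_setOf_evalAt_mem {U : C.Opens} (g : Γ(C, U)) {W : Set L} (hW : IsOpen W) :
    IsOpen {x : Points c φ | pt x.1 ∈ U ∧ evalAt x.1 g ∈ W} :=
  TopologicalSpace.isOpen_generateFrom_of_mem ⟨U, g, W, hW, rfl⟩

theorem eventually_pt_mem (x : Points c φ) {U : C.Opens} (hx : pt x.1 ∈ U) :
    ∀ᶠ y in 𝓝 x, pt y.1 ∈ U := by
  filter_upwards [(isOpen_setOf_evalAt_mem (c := c) (φ := φ) (0 : Γ(C, U)) isOpen_univ).mem_nhds
    ⟨hx, trivial⟩] with y hy using hy.1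

theorem tendsto_evalAt (x : Points c φ) {U : C.Opens} (hx : pt x.1 ∈ U) (g : Γ(C, U)) :
    Filter.Tendsto (fun y : Points c φ => evalAt y.1 g) (𝓝 x) (𝓝 (evalAt x.1 g)) := by
  intro s hs
  obtain ⟨W, hWs, hW, hxW⟩ := mem_nhds_iff.1 hs
  exact Filter.mem_map.2 <| Filter.mem_of_superset
    ((isOpen_setOf_evalAt_mem g hW).mem_nhds ⟨hx, hxW⟩) fun y hy => hWs hy.2

end Topology

namespace RegularModel

variable {K : Type u} [Field K] [NumberField K] {C : Scheme.{u}} {c : C ⟶ Spec (.of K)}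
  {M : RegularModel c} {𝔭 : HeightOneSpectrum (𝓞 K)}

section Points

variable {L : Type u} [Field L] {φ : K →+* L} (y : Points c φ)

theorem toPoints_comp_comp_f :
    (y.1 ≫ M.j) ≫ M.f = Spec.map (CommRingCat.ofHom (φ.comp (algebraMap (𝓞 K) K))) := by
  rw [Category.assoc, M.isPullback.w, ← Category.assoc, y.2, ← Spec.map_comp,
    ← CommRingCat.ofHom_comp]

theorem evalAt_constants {U : M.X.Opens} (hy : pt y.1 ∈ M.j ⁻¹ᵁ U) (a : 𝓞 K) :
    evalAt y.1 ((M.j.app U).hom (constants M.f U a)) = φ (algebraMap (𝓞 K) K a) := by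
  have hyU : (y.1 ≫ M.j) (closedPoint L) ∈ U := hy
  rw [evalAt_eq_evalHom _ hy, ← evalHom_comp y.1 M.j hyU hy]
  exact evalHom_constants M.f _ _ (toPoints_comp_comp_f y) hyU a

end Points

section ValueAt

variable (x : KPoints c) {z : M.X} (h : M.j (pt x.1) ⤳ z)

/-- The value at the rational point `x` of the generic fibre of a germ at a point `z` of the closure
of `x`. -/
def valueAt : M.X.presheaf.stalk z →+* K := x.ev.comp (germMap M.j h)

theorem valueAt_germ {U : M.X.Opens} (hz : z ∈ U) (g : Γ(M.X, U)) :
    valueAt x h ((M.X.presheaf.germ U z hz).hom g) = evalAt x.1 ((M.j.app U).hom g) := by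
  rw [valueAt, RingHom.comp_apply, germMap_germ h hz]
  exact x.ev_germ _ _

theorem mem_idealAt_iff (g : M.X.presheaf.stalk z) :
    g ∈ M.idealAt (M.j (pt x.1)) z ↔ valueAt x h g = 0 := by
  rw [idealAt, dif_pos h, valueAt, RingHom.comp_apply, x.ev_eq_zero_iff, germMap,
    RingHom.comp_apply, Ideal.mem_comap, mem_maximalIdeal, mem_maximalIdeal, mem_nonunits_iff,
    mem_nonunits_iff, isUnit_map_iff (M.j.stalkMap (pt x.1)).hom]

theorem mem_maximalIdeal_of_valueAt_eq_zero {g : M.X.presheaf.stalk z} (hg : valueAt x h g = 0) :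
    g ∈ maximalIdeal (M.X.presheaf.stalk z) := by
  rw [← mem_idealAt_iff, idealAt, dif_pos h] at hg
  exact le_maximalIdeal (Ideal.IsPrime.comap _).ne_top hg

theorem valueAt_stalkConstants (a : 𝓞 K) :
    valueAt x h (stalkConstants M.f z a) = algebraMap (𝓞 K) K a := by
  have hx : (x.1 ≫ M.j) ≫ M.f = Spec.map (CommRingCat.ofHom (algebraMap (𝓞 K) K)) := by
    rw [Category.assoc, M.isPullback.w, ← Category.assoc, x.2, Category.id_comp]
  have h_top : pt x.1 ∈ M.j ⁻¹ᵁ ⊤ := trivial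
  refine (valueAt_germ x h (U := ⊤) trivial _).trans ?_
  rw [evalAt_eq_evalHom _ h_top, ← evalHom_comp x.1 M.j (U := ⊤) trivial h_top]
  exact evalHom_constants M.f _ _ hx (U := ⊤) trivial a

theorem mul_sub_mem_maximalIdeal {g : M.X.presheaf.stalk z} {n d : 𝓞 K}
    (hnd : valueAt x h g * algebraMap (𝓞 K) K d = algebraMap (𝓞 K) K n) :
    g * stalkConstants M.f z d - stalkConstants M.f z n ∈
      maximalIdeal (M.X.presheaf.stalk z) := by
  refine mem_maximalIdeal_of_valueAt_eq_zero x h ?_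
  rw [map_sub, map_mul, valueAt_stalkConstants, valueAt_stalkConstants, hnd, sub_self]

section PointAbovePrime

theorem stalkConstants_mem_maximalIdeal_iff_mem (hz : M.f z = primePt 𝔭) (a : 𝓞 K) :
    stalkConstants M.f z a ∈ maximalIdeal (M.X.presheaf.stalk z) ↔ a ∈ 𝔭.asIdeal := by
  rw [stalkConstants_mem_maximalIdeal_iff, hz]
  rfl

theorem isUnit_stalkConstants (hz : M.f z = primePt 𝔭) {d : 𝓞 K} (hd : d ∉ 𝔭.asIdeal) :
    IsUnit (stalkConstants M.f z d) := by
  rwa [← stalkConstants_mem_maximalIdeal_iff_mem hz, mem_maximalIdeal, mem_nonunits_iff, not_not]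
    at hd

variable (hz : M.f z = primePt 𝔭)
include hz

theorem exists_valueAt_mul_eq (g : M.X.presheaf.stalk z) :
    ∃ n d : 𝓞 K, d ∉ 𝔭.asIdeal ∧
      valueAt x h g * algebraMap (𝓞 K) K d = algebraMap (𝓞 K) K n := by
  obtain ⟨n, d, hnd | hnd⟩ := 𝔭.exists_primeCompl_mul_eq_or_mul_eq (K := K) (valueAt x h g)
  · exact ⟨n, d, d.2, hnd⟩
  · refine ⟨d, n, fun hn => d.2 ?_, hnd⟩
    rw [← stalkConstants_mem_maximalIdeal_iff_mem hz] at hn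
    rw [SetLike.mem_coe, ← stalkConstants_mem_maximalIdeal_iff_mem hz]
    simpa only [sub_sub_cancel] using
      Ideal.sub_mem _ (Ideal.mul_mem_left _ g hn) (mul_sub_mem_maximalIdeal x h hnd)

theorem exists_valuation_valueAt_eq (g : M.X.presheaf.stalk z) :
    ∃ n : 𝓞 K, 𝔭.valuation K (valueAt x h g) = 𝔭.valuation K (algebraMap (𝓞 K) K n) ∧
      (g ∈ maximalIdeal (M.X.presheaf.stalk z) ↔ n ∈ 𝔭.asIdeal) := by
  obtain ⟨n, d, hd, hnd⟩ := exists_valueAt_mul_eq x h hz g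
  refine ⟨n, ?_, ?_⟩
  · rw [← hnd, map_mul, (𝔭.valuation_eq_one_iff_notMem (K := K)).2 hd, mul_one]
  · rw [← stalkConstants_mem_maximalIdeal_iff_mem hz,
      ← Ideal.mul_unit_mem_iff_mem _ (isUnit_stalkConstants hz hd)]
    exact (Submodule.sub_mem_iff_left _ (mul_sub_mem_maximalIdeal x h hnd)).symm.trans
      (by rw [sub_sub_cancel])

theorem valuation_valueAt_le_one (g : M.X.presheaf.stalk z) :
    𝔭.valuation K (valueAt x h g) ≤ 1 := by
  obtain ⟨n, hn, -⟩ := exists_valuation_valueAt_eq x h hz g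
  exact hn ▸ 𝔭.valuation_le_one n

theorem valuation_valueAt_lt_one_iff (g : M.X.presheaf.stalk z) :
    𝔭.valuation K (valueAt x h g) < 1 ↔ g ∈ maximalIdeal (M.X.presheaf.stalk z) := by
  obtain ⟨n, hn, hg⟩ := exists_valuation_valueAt_eq x h hz g
  rw [hg, hn, 𝔭.valuation_lt_one_iff_mem]

theorem exists_valueAt_eq {a : K} (ha : 𝔭.valuation K a ≤ 1) :
    ∃ g : M.X.presheaf.stalk z, valueAt x h g = a := by
  obtain ⟨n, d, hnd⟩ := 𝔭.exists_primeCompl_mul_eq_of_integer a ha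
  obtain ⟨e, he⟩ := (isUnit_stalkConstants hz d.2).exists_right_inv
  have he' : algebraMap (𝓞 K) K d * valueAt x h e = 1 := by
    rw [← valueAt_stalkConstants x h, ← map_mul, he, map_one]
  refine ⟨stalkConstants M.f z n * e, ?_⟩
  rw [map_mul, valueAt_stalkConstants, ← hnd, mul_assoc, he', mul_one]

end PointAbovePrime

end ValueAt

end RegularModel

section ResidueDegree

theorem residue_stalkConstants_mem_fieldRange {X : Scheme.{u}} {B : Type u} [CommRing B]
    (f : X ⟶ Spec (.of B)) (z : X) (b : B) :
    X.residue z (stalkConstants f z b) ∈ (f.residueFieldMap z).hom.fieldRange := by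
  let s : Γ(Spec (.of B), ⊤) := (Scheme.ΓSpecIso (.of B)).inv b
  let b' : (Spec (.of B)).presheaf.stalk (f z) :=
    (Spec (.of B)).presheaf.germ ⊤ (f z) trivial s
  have h_stalk : (f.stalkMap z).hom b' = stalkConstants f z b := by
    rw [stalkConstants, constants, ← appTop_eq_appLE]
    exact congr($(Scheme.Hom.germ_stalkMap f ⊤ z trivial).hom s)
  rw [← h_stalk]
  exact ⟨(Spec (.of B)).residue (f z) b', congr($(Scheme.residue_residueFieldMap f z).hom b')⟩

variable {K : Type u} [Field K] [NumberField K] {C : Scheme.{u}} {c : C ⟶ Spec (.of K)}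
  {M : RegularModel c} {𝔭 : HeightOneSpectrum (𝓞 K)} (x : KPoints c) {z : M.X}

theorem RegularModel.residueDegree_eq_one (h : M.j (pt x.1) ⤳ z) (hz : M.f z = primePt 𝔭) :
    M.f.residueDegree z = 1 := by
  have h_surj : Function.Surjective (M.f.residueFieldMap z).hom := by
    intro y
    obtain ⟨g, rfl⟩ := M.X.residue_surjective z y
    obtain ⟨n, d, hd, hnd⟩ := exists_valueAt_mul_eq x h hz g
    have h_mul : M.X.residue z g * M.X.residue z (stalkConstants M.f z d) =
        M.X.residue z (stalkConstants M.f z n) := by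
      rw [← map_mul, ← sub_eq_zero, ← map_sub]
      exact Ideal.Quotient.eq_zero_iff_mem.2 (mul_sub_mem_maximalIdeal x h hnd)
    have hd_ne : M.X.residue z (stalkConstants M.f z d) ≠ 0 :=
      ((isUnit_stalkConstants hz hd).map (M.X.residue z).hom).ne_zero
    rw [eq_div_of_mul_eq hd_ne h_mul]
    exact RingHom.mem_fieldRange.1 (div_mem (residue_stalkConstants_mem_fieldRange M.f z n)
      (residue_stalkConstants_mem_fieldRange M.f z d))
  let := (M.f.residueFieldMap z).hom.toAlgebra
  refine finrank_eq_one (1 : M.X.residueField z) one_ne_zero fun w => ?_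
  obtain ⟨y, rfl⟩ := h_surj w
  exact ⟨y, by rw [Algebra.smul_def, mul_one]; rfl⟩

end ResidueDegree

section Norm

variable {K : Type u} [Field K] [NumberField K] {𝔭 : HeightOneSpectrum (𝓞 K)} {L : Type u}
  [NormedField L] {φ : K →+* L} (hn : ∀ a : K, ‖φ a‖ = NumberField.HeightOneSpectrum.adicAbv K 𝔭 a)
include hn

theorem norm_le_norm_iff (a b : K) : ‖φ a‖ ≤ ‖φ b‖ ↔ 𝔭.valuation K a ≤ 𝔭.valuation K b := by
  rw [hn, hn, NumberField.HeightOneSpectrum.adicAbv_def, NumberField.HeightOneSpectrum.adicAbv_def,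
    NNReal.coe_le_coe]
  exact (WithZeroMulInt.toNNReal_strictMono
      (NumberField.HeightOneSpectrum.one_lt_absNorm_nnreal 𝔭)).le_iff_le

theorem norm_le_one_iff (a : K) : ‖φ a‖ ≤ 1 ↔ 𝔭.valuation K a ≤ 1 := by
  simpa only [map_one, norm_one] using norm_le_norm_iff hn a 1

theorem norm_lt_one_iff (a : K) : ‖φ a‖ < 1 ↔ 𝔭.valuation K a < 1 := by
  simpa only [map_one, norm_one, not_le] using (norm_le_norm_iff hn 1 a).not

theorem norm_lt_one_iff_mem (a : 𝓞 K) : ‖φ (algebraMap (𝓞 K) K a)‖ < 1 ↔ a ∈ 𝔭.asIdeal := by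
  rw [norm_lt_one_iff hn, 𝔭.valuation_lt_one_iff_mem]

theorem log_norm {a : K} {k : ℤ} (ha : 𝔭.valuation K a = WithZero.exp k) :
    Real.log ‖φ a‖ = k * Real.log (Ideal.absNorm 𝔭.asIdeal) := by
  rw [hn, NumberField.HeightOneSpectrum.adicAbv_def, ha,
    WithZeroMulInt.toNNReal_neg_apply _ WithZero.exp_ne_zero]
  push_cast
  rw [Real.log_zpow]
  rfl

end Norm

namespace RegularModel

section IntRing

variable {L : Type u} [NormedField L] [IsUltrametricDist L]

theorem mem_intRing_iff (a : L) : a ∈ intRing L ↔ ‖a‖ ≤ 1 := Iff.rfl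

theorem mem_maximalIdeal_intRing_iff (a : intRing L) :
    a ∈ maximalIdeal (intRing L) ↔ ‖(a : L)‖ < 1 :=
  (NormedField.valuation (K := L)).mem_maximalIdeal_iff

variable (L) in
/-- The inclusion of the generic point of the spectrum of the valuation ring of `L`. -/
abbrev specIntRing : Spec (.of L) ⟶ Spec (.of (intRing L)) :=
  Spec.map (CommRingCat.ofHom (algebraMap (intRing L) L))

theorem eq_of_specIntRing_comp_specMap_eq {B : Type u} [CommRing B] {ψ₁ ψ₂ : B →+* intRing L}
    (h : specIntRing L ≫ Spec.map (CommRingCat.ofHom ψ₁) =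
      specIntRing L ≫ Spec.map (CommRingCat.ofHom ψ₂)) : ψ₁ = ψ₂ := by
  rw [← Spec.map_comp, ← Spec.map_comp] at h
  ext b
  exact congr($(Spec.map_injective h).hom b)

end IntRing

variable {K : Type u} [Field K] [NumberField K] {C : Scheme.{u}} {c : C ⟶ Spec (.of K)}
  (M : RegularModel c) {𝔭 : HeightOneSpectrum (𝓞 K)} {L : Type u} [NormedField L]
  [IsUltrametricDist L] {φ : K →+* L} (hφ : ∀ a : 𝓞 K, ‖φ (algebraMap (𝓞 K) K a)‖ ≤ 1)

theorem specIntRing_comp_extension (y : Points c φ) :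
    specIntRing L ≫ M.extension hφ y = y.1 ≫ M.j :=
  (M.exists_extension hφ y).choose_spec

theorem comp_f_eq_of_specIntRing_comp {y : Points c φ} {s : Spec (.of (intRing L)) ⟶ M.X}
    (hs : specIntRing L ≫ s = y.1 ≫ M.j) :
    s ≫ M.f = Spec.map (CommRingCat.ofHom
      ((φ.comp (algebraMap (𝓞 K) K)).codRestrict (intRing L) hφ)) := by
  obtain ⟨ψ, hψ⟩ := Spec.map_surjective (s ≫ M.f)
  rw [← hψ]
  refine congrArg (fun χ => Spec.map (CommRingCat.ofHom χ))
    (eq_of_specIntRing_comp_specMap_eq (ψ₁ := ψ.hom) ?_)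
  rw [CommRingCat.ofHom_hom, hψ, ← Category.assoc, hs, toPoints_comp_comp_f, ← Spec.map_comp]
  rfl

variable {M} in
theorem eq_extension {y : Points c φ} {s : Spec (.of (intRing L)) ⟶ M.X}
    (hs : specIntRing L ≫ s = y.1 ≫ M.j) : s = M.extension hφ y := by
  have h_ext := M.specIntRing_comp_extension hφ y
  have h_base : M.extension hφ y ≫ M.f = s ≫ M.f :=
    (M.comp_f_eq_of_specIntRing_comp hφ h_ext).trans (M.comp_f_eq_of_specIntRing_comp hφ hs).symm
  have := M.isProper
  have h_uniq : ValuativeCriterion.Uniqueness M.f := IsSeparated.valuativeCriterion M.f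
  let sq : ValuativeCommSq M.f :=
    { R := intRing L
      K := L
      i₁ := y.1 ≫ M.j
      i₂ := s ≫ M.f
      commSq := ⟨by rw [← hs, Category.assoc]⟩ }
  let l₁ : sq.commSq.LiftStruct := ⟨s, hs, rfl⟩
  let l₂ : sq.commSq.LiftStruct := ⟨M.extension hφ y, h_ext, h_base⟩
  have := h_uniq sq
  exact congrArg CommSq.LiftStruct.l (Subsingleton.elim l₁ l₂)

/-- The specialization of an `L`-valued point, that is, the image of the closed point of `Spec 𝓞_L`
under its extension to the model. -/
def center (y : Points c φ) : M.X := M.extension hφ y (closedPoint (intRing L))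

theorem j_specializes_center (y : Points c φ) : M.j (pt y.1) ⤳ M.center hφ y := by
  have h_eq : M.j (pt y.1) = M.extension hφ y (specIntRing L (closedPoint L)) :=
    congr($(M.specIntRing_comp_extension hφ y) (closedPoint L)).symm
  rw [h_eq]
  exact (IsLocalRing.specializes_closedPoint _).map (M.extension hφ y).continuous

theorem evalHom_extension (y : Points c φ) {U : M.X.Opens}
    (hU : M.extension hφ y (closedPoint (intRing L)) ∈ U) (g : Γ(M.X, U)) :
    ((evalHom (M.extension hφ y) U hU g : intRing L) : L) = evalAt y.1 ((M.j.app U).hom g) := by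
  have hy : pt y.1 ∈ M.j ⁻¹ᵁ U := (M.j_specializes_center hφ y).mem_open U.2 hU
  have h_ext := M.specIntRing_comp_extension hφ y
  have hU₁ : (y.1 ≫ M.j) (closedPoint L) ∈ U := hy
  have hU₂ : (specIntRing L ≫ M.extension hφ y) (closedPoint L) ∈ U := h_ext ▸ hU₁
  rw [evalAt_eq_evalHom _ hy, ← evalHom_comp y.1 M.j hU₁ hy, ← evalHom_congr h_ext hU₂ hU₁]
  exact (evalHom_specMap_comp _ _ hU hU₂ g).symm

section Center

variable (hn : ∀ a : K, ‖φ a‖ = NumberField.HeightOneSpectrum.adicAbv K 𝔭 a)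
include hn

theorem f_center (y : Points c φ) : M.f (M.center hφ y) = primePt 𝔭 := by
  have h_comp : M.f (M.center hφ y) = (M.extension hφ y ≫ M.f) (closedPoint (intRing L)) := rfl
  rw [h_comp, M.comp_f_eq_of_specIntRing_comp hφ (M.specIntRing_comp_extension hφ y)]
  exact PrimeSpectrum.ext (Ideal.ext fun a =>
    (mem_maximalIdeal_intRing_iff _).trans (norm_lt_one_iff_mem hn a))

-- The germs at `z` have integral values at `x`, which turns `x` into a point of `M` with values in
-- `𝓞_L` and centre `z`; the valuative criterion identifies it with the extension of `x`.
theorem eq_center (x : KPoints c) {z : M.X} (h : M.j (pt x.1) ⤳ z) (hz : M.f z = primePt 𝔭) :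
    z = M.center hφ (x.toPoints φ) := by
  let ψ : M.X.presheaf.stalk z →+* intRing L :=
    (φ.comp (valueAt x h)).codRestrict (intRing L) fun g =>
      (mem_intRing_iff _).2 ((norm_le_one_iff hn _).2 (valuation_valueAt_le_one x h hz g))
  have hψ : IsLocalHom ψ := by
    refine ((local_hom_TFAE ψ).out 0 3).2 fun g hg => ?_
    rw [Ideal.mem_comap, mem_maximalIdeal_intRing_iff]
    exact (norm_lt_one_iff hn _).2 ((valuation_valueAt_lt_one_iff x h hz g).2 hg)
  let s : Spec (.of (intRing L)) ⟶ M.X := Spec.map (CommRingCat.ofHom ψ) ≫ M.X.fromSpecStalk z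
  have hs : specIntRing L ≫ s = (x.toPoints φ).1 ≫ M.j := by
    have h_value : (M.X.presheaf.stalkSpecializes h ≫ M.j.stalkMap (x.1 (closedPoint K)) ≫
        Scheme.stalkClosedPointTo x.1) ≫ CommRingCat.ofHom φ =
        CommRingCat.ofHom ψ ≫ CommRingCat.ofHom (algebraMap (intRing L) L) := rfl
    rw [← Category.assoc, ← Spec.map_comp, ← h_value, Spec.map_comp, Category.assoc]
    exact congrArg (Spec.map (CommRingCat.ofHom φ) ≫ ·) (specMap_comp_fromSpecStalk x.1 M.j h)
  have h_closed : Spec.map (CommRingCat.ofHom ψ) (closedPoint (intRing L)) = closedPoint _ :=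
    comap_closedPoint ψ
  rw [center, ← eq_extension hφ hs]
  exact (Scheme.fromSpecStalk_closedPoint.symm.trans
    (congrArg (M.X.fromSpecStalk z) h_closed.symm) :)

end Center

end RegularModel

section Ultrametric

theorem norm_le_max_norm_sub {E : Type*} [SeminormedAddCommGroup E] [IsUltrametricDist E]
    (a b : E) : ‖a‖ ≤ max ‖a - b‖ ‖b‖ := by
  simpa only [sub_add_cancel] using IsUltrametricDist.norm_add_le_max (a - b) b

theorem norm_lt_one_iff_of_norm_sub_lt_one {E : Type*} [SeminormedAddCommGroup E]
    [IsUltrametricDist E] {a b : E} (h : ‖a - b‖ < 1) : ‖a‖ < 1 ↔ ‖b‖ < 1 :=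
  ⟨fun ha => (norm_le_max_norm_sub b a).trans_lt (max_lt (norm_sub_rev a b ▸ h) ha),
    fun hb => (norm_le_max_norm_sub a b).trans_lt (max_lt h hb)⟩

variable {B L : Type*} [CommRing B] [NormedField L] [IsUltrametricDist L] {f g : B →+* L}

/-- The subring on which two ring homomorphisms to an ultrametric field, the second of them with
integral values, agree modulo elements of norm less than one. -/
def congruenceSubring (f : B →+* L) (hg : ∀ b, ‖g b‖ ≤ 1) : Subring B where
  carrier := {b | ‖f b - g b‖ < 1}
  mul_mem' {a b} (ha : ‖f a - g a‖ < 1) (hb : ‖f b - g b‖ < 1) := by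
    have hfa : ‖f a‖ ≤ 1 := (norm_le_max_norm_sub _ _).trans (max_le ha.le (hg a))
    have h_split : f (a * b) - g (a * b) = f a * (f b - g b) + (f a - g a) * g b := by
      rw [map_mul, map_mul]
      ring
    rw [Set.mem_ofPred_eq, h_split]
    refine (IsUltrametricDist.norm_add_le_max _ _).trans_lt (max_lt ?_ ?_)
    · exact (norm_mul _ _).trans_lt ((mul_le_of_le_one_left (norm_nonneg _) hfa).trans_lt hb)
    · exact (norm_mul _ _).trans_lt ((mul_le_of_le_one_right (norm_nonneg _) (hg b)).trans_lt ha)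
  one_mem' := by simp
  add_mem' {a b} ha hb := by
    rw [Set.mem_ofPred_eq, map_add, map_add, add_sub_add_comm]
    exact (IsUltrametricDist.norm_add_le_max _ _).trans_lt (max_lt ha hb)
  zero_mem' := by simp
  neg_mem' {a} ha := by
    rw [Set.mem_ofPred_eq, map_neg, map_neg, neg_sub_neg, norm_sub_rev]
    exact ha

theorem mem_congruenceSubring_iff (hg : ∀ b, ‖g b‖ ≤ 1) {b : B} :
    b ∈ congruenceSubring f hg ↔ ‖f b - g b‖ < 1 := Iff.rfl

end Ultrametric

section FiniteType

theorem exists_finset_forall_subring_eq_top {A B : Type*} [CommRing A] [CommRing B] {i : A →+* B}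
    (hi : i.FiniteType) :
    ∃ s : Finset B, ∀ T : Subring B, (∀ a, i a ∈ T) → (∀ b ∈ s, b ∈ T) → T = ⊤ := by
  let := i.toAlgebra
  obtain ⟨s, hs⟩ := hi.out
  refine ⟨s, fun T hT hsT => (Subring.eq_top_iff' T).2 fun b => ?_⟩
  let T' : Subalgebra A B := { T with algebraMap_mem' := hT }
  have hT' : T' = ⊤ := eq_top_iff.2 (hs ▸ Algebra.adjoin_le hsT)
  exact (hT' ▸ Algebra.mem_top : b ∈ T')

theorem finiteType_constants {X : Scheme.{u}} {B : Type u} [CommRing B] (f : X ⟶ Spec (.of B))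
    [LocallyOfFiniteType f] {W : X.Opens} (hW : IsAffineOpen W) : (constants f W).FiniteType :=
  (f.finiteType_appLE (isAffineOpen_top _) hW (le_preimage_top f W)).comp
    (RingHom.FiniteType.of_surjective _
      (ConcreteCategory.bijective_of_isIso (Scheme.ΓSpecIso (.of B)).inv).2)

end FiniteType

namespace RegularModel

variable {K : Type u} [Field K] [NumberField K] {C : Scheme.{u}} {c : C ⟶ Spec (.of K)}
  (M : RegularModel c) {L : Type u} [NormedField L] {φ : K →+* L} (y : Points c φ) {W : M.X.Opens}
  (hy : pt y.1 ∈ M.j ⁻¹ᵁ W)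

/-- Evaluation at an `L`-valued point of the functions on an open subset of the model. -/
def chartEval (W : M.X.Opens) (hy : pt y.1 ∈ M.j ⁻¹ᵁ W) : Γ(M.X, W) →+* L :=
  (evalHom y.1 (M.j ⁻¹ᵁ W) hy).comp (M.j.app W).hom

theorem chartEval_apply (b : Γ(M.X, W)) :
    M.chartEval y W hy b = evalAt y.1 ((M.j.app W).hom b) :=
  (evalAt_eq_evalHom _ hy _).symm

theorem chartEval_constants (a : 𝓞 K) :
    M.chartEval y W hy (constants M.f W a) = φ (algebraMap (𝓞 K) K a) := by
  rw [chartEval_apply, evalAt_constants y hy]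

theorem specMap_chartEval_fromSpec (hW : IsAffineOpen W) :
    Spec.map (CommRingCat.ofHom (M.chartEval y W hy)) ≫ hW.fromSpec = y.1 ≫ M.j := by
  have hy' : (y.1 ≫ M.j) (closedPoint L) ∈ W := hy
  rw [← specMap_evalHom_fromSpec (y.1 ≫ M.j) hW hy']
  congr 3
  ext b
  exact (evalHom_comp y.1 M.j hy' hy b).symm

variable [IsUltrametricDist L] (hφ : ∀ a : 𝓞 K, ‖φ (algebraMap (𝓞 K) K a)‖ ≤ 1)

theorem norm_chartEval_le_one (hz : M.center hφ y ∈ W) (b : Γ(M.X, W)) :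
    ‖M.chartEval y W hy b‖ ≤ 1 := by
  rw [chartEval_apply, ← M.evalHom_extension hφ y hz]
  exact (mem_intRing_iff _).1 (Subtype.prop _)

theorem center_eq_fromSpec (hW : IsAffineOpen W) (h : ∀ b, ‖M.chartEval y W hy b‖ ≤ 1) :
    M.center hφ y = hW.fromSpec (Spec.map (CommRingCat.ofHom
      ((M.chartEval y W hy).codRestrict (intRing L) h)) (closedPoint (intRing L))) := by
  let ψ := (M.chartEval y W hy).codRestrict (intRing L) h
  have hs : specIntRing L ≫ Spec.map (CommRingCat.ofHom ψ) ≫ hW.fromSpec = y.1 ≫ M.j := by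
    rw [← M.specMap_chartEval_fromSpec y hy hW, ← Category.assoc, ← Spec.map_comp]
    rfl
  rw [center, ← eq_extension hφ hs]
  rfl

theorem center_eq_of_norm_chartEval_sub_lt_one {y y' : Points c φ} (hW : IsAffineOpen W)
    (hy : pt y.1 ∈ M.j ⁻¹ᵁ W) (hy' : pt y'.1 ∈ M.j ⁻¹ᵁ W) (hz : M.center hφ y ∈ W)
    (h : ∀ b, ‖M.chartEval y' W hy' b - M.chartEval y W hy b‖ < 1) :
    M.center hφ y' = M.center hφ y := by
  have h_int := M.norm_chartEval_le_one y hy hφ hz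
  rw [M.center_eq_fromSpec y hy hφ hW h_int, M.center_eq_fromSpec y' hy' hφ hW fun b =>
    (norm_le_max_norm_sub _ _).trans (max_le (h b).le (h_int b))]
  congr 1
  refine PrimeSpectrum.ext (Ideal.ext fun b => ?_)
  refine (mem_maximalIdeal_intRing_iff _).trans (Iff.trans ?_ (mem_maximalIdeal_intRing_iff _).symm)
  exact norm_lt_one_iff_of_norm_sub_lt_one (h b)

-- On an affine neighbourhood of the centre of `y`, which is of finite type over `𝓞_K`, closeness
-- has to be checked on finitely many generators only.
theorem eventually_center_eq : ∀ᶠ y' in 𝓝 y, M.center hφ y' = M.center hφ y := by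
  obtain ⟨_, ⟨W, hW, rfl⟩, hzW, -⟩ := M.X.isBasis_affineOpens.exists_subset_of_mem_open
    (Set.mem_univ (M.center hφ y)) isOpen_univ
  have hy : pt y.1 ∈ M.j ⁻¹ᵁ W := (M.j_specializes_center hφ y).mem_open W.2 hzW
  have := M.isProper
  obtain ⟨s, hs⟩ := exists_finset_forall_subring_eq_top (finiteType_constants M.f hW)
  have h_close : ∀ᶠ y' in 𝓝 y, ∀ b ∈ s, ‖evalAt y'.1 ((M.j.app W).hom b) -
      evalAt y.1 ((M.j.app W).hom b)‖ < 1 := by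
    refine (Filter.eventually_all_finset s).2 fun b _ => ?_
    filter_upwards [(tendsto_evalAt y hy ((M.j.app W).hom b)).eventually
      (Metric.ball_mem_nhds _ one_pos)] with y' hy'
    rwa [← dist_eq_norm]
  filter_upwards [eventually_pt_mem y hy, h_close] with y' hy' h_close
  have h_top := hs (congruenceSubring (M.chartEval y' W hy') (M.norm_chartEval_le_one y hy hφ hzW))
    (fun a => by
      rw [mem_congruenceSubring_iff, chartEval_constants, chartEval_constants, sub_self, norm_zero]
      exact one_pos)
    (fun b hb => by
      rw [mem_congruenceSubring_iff, chartEval_apply, chartEval_apply]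
      exact h_close b hb)
  exact M.center_eq_of_norm_chartEval_sub_lt_one hφ hW hy hy' hzW fun b =>
    (mem_congruenceSubring_iff _).1 (h_top ▸ Subring.mem_top b)

end RegularModel

section StalkEval

variable {K : Type u} [Field K] {C : Scheme.{u}} {c : C ⟶ Spec (.of K)} {L : Type u}
  [NormedField L] {φ : K →+* L}

theorem eventually_evalAt_eq {y : Points c φ} {x : C} (hx : pt y.1 = x) {U V : C.Opens}
    (hU : x ∈ U) (hV : x ∈ V) {g : Γ(C, U)} {g' : Γ(C, V)}
    (h : (C.presheaf.germ U x hU).hom g = (C.presheaf.germ V x hV).hom g') :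
    ∀ᶠ y' in 𝓝 y, evalAt y'.1 g = evalAt y'.1 g' := by
  obtain ⟨W, hW, iU, iV, e⟩ := C.presheaf.germ_eq x hU hV g g' h
  filter_upwards [eventually_pt_mem y (hx ▸ hW)] with y' hy'
  exact (evalAt_restrict iU hy' g).symm.trans ((congrArg _ e).trans (evalAt_restrict iV hy' g'))

/-- The value of a germ of functions at an `L`-valued point `y`. It is computed with a chosen
representative, so that it is meaningful only for `y` close to the base point of the germ. -/
def stalkEval {x : C} (e : C.presheaf.stalk x) (y : Points c φ) : L :=
  evalAt y.1 (C.presheaf.exists_germ_eq e).choose_spec.choose_spec.choose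

theorem eventually_stalkEval_eq {y : Points c φ} {x : C} (hx : pt y.1 = x)
    {e : C.presheaf.stalk x} {U : C.Opens} (hU : x ∈ U) {g : Γ(C, U)}
    (h : (C.presheaf.germ U x hU).hom g = e) :
    ∀ᶠ y' in 𝓝 y, stalkEval e y' = evalAt y'.1 g := by
  have h_rep := C.presheaf.exists_germ_eq e
  exact eventually_evalAt_eq hx h_rep.choose_spec.choose hU
    (h_rep.choose_spec.choose_spec.choose_spec.trans h.symm)

theorem tendsto_stalkEval {y : Points c φ} {x : C} (hx : pt y.1 = x) (e : C.presheaf.stalk x) :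
    Filter.Tendsto (stalkEval e) (𝓝 y) (𝓝 (stalkEval e y)) :=
  tendsto_evalAt y (hx ▸ (C.presheaf.exists_germ_eq e).choose_spec.choose) _

theorem eventually_stalkEval_mul {y : Points c φ} {x : C} (hx : pt y.1 = x)
    (e e' : C.presheaf.stalk x) :
    ∀ᶠ y' in 𝓝 y, stalkEval (e * e') y' = stalkEval e y' * stalkEval e' y' := by
  obtain ⟨U, hU, g, hg⟩ := C.presheaf.exists_germ_eq e
  obtain ⟨U', hU', g', hg'⟩ := C.presheaf.exists_germ_eq e'
  let i : U ⊓ U' ⟶ U := homOfLE inf_le_left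
  let i' : U ⊓ U' ⟶ U' := homOfLE inf_le_right
  have hx' : x ∈ U ⊓ U' := ⟨hU, hU'⟩
  have h_mul : (C.presheaf.germ (U ⊓ U') x hx').hom
      ((C.presheaf.map i.op).hom g * (C.presheaf.map i'.op).hom g') = e * e' := by
    rw [map_mul]
    congr 1
    · exact (C.presheaf.germ_res_apply i x hx' g).trans hg
    · exact (C.presheaf.germ_res_apply i' x hx' g').trans hg'
  filter_upwards [eventually_stalkEval_eq hx hU hg, eventually_stalkEval_eq hx hU' hg',
    eventually_stalkEval_eq hx hx' h_mul, eventually_pt_mem y (hx ▸ hx')]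
    with y' h_e h_e' h_ee' hy'
  rw [h_e, h_e', h_ee', evalAt_mul hy', evalAt_restrict i hy', evalAt_restrict i' hy']

theorem stalkEval_toPoints (x : KPoints c) (e : C.presheaf.stalk (pt x.1)) :
    stalkEval e (x.toPoints φ) = φ (x.ev e) := by
  obtain ⟨U, hU, g, hg⟩ := C.presheaf.exists_germ_eq e
  rw [(eventually_stalkEval_eq (pt_toPoints x φ) hU hg).self_of_nhds, evalAt_toPoints x φ hU,
    ← x.ev_germ hU]
  exact congrArg (fun a => φ (x.ev a)) hg

end StalkEval

theorem sSup_norm_span {L R : Type*} [NormedField L] [IsUltrametricDist L] [CommRing R]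
    (σ : R →+* L) (hσ : ∀ a, ‖σ a‖ ≤ 1) (s : Finset R) :
    sSup ((fun g => ‖σ g‖) '' (Ideal.span (s : Set R) : Set R)) =
      (s.sup fun a => ‖σ a‖₊ : ℝ≥0) := by
  have h_le : ∀ g ∈ Ideal.span (s : Set R), ‖σ g‖₊ ≤ s.sup fun a => ‖σ a‖₊ := by
    intro g hg
    induction hg using Submodule.span_induction with
    | mem a ha => exact Finset.le_sup (f := fun a => ‖σ a‖₊) ha
    | zero => simp
    | add a b _ _ ha hb =>
      rw [map_add]
      exact (IsUltrametricDist.nnnorm_add_le_max _ _).trans (max_le ha hb)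
    | smul a b _ hb =>
      rw [smul_eq_mul, map_mul, nnnorm_mul]
      exact (mul_le_of_le_one_left zero_le (show ‖σ a‖₊ ≤ 1 from hσ a)).trans hb
  rcases s.eq_empty_or_nonempty with rfl | hs
  · simp
  obtain ⟨a, ha, h_max⟩ := s.exists_mem_eq_sup hs fun a => ‖σ a‖₊
  refine IsGreatest.csSup_eq ⟨⟨a, Ideal.subset_span ha, ?_⟩, ?_⟩
  · rw [h_max, coe_nnnorm]
  · rintro _ ⟨g, hg, rfl⟩
    exact h_le g hg

namespace RegularModel

variable {K : Type u} [Field K] [NumberField K] {C : Scheme.{u}} {c : C ⟶ Spec (.of K)}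
  (M : RegularModel c) (𝔭 : HeightOneSpectrum (𝓞 K)) {L : Type u} [NormedField L]
  [IsUltrametricDist L] {φ : K →+* L} (hφ : ∀ a : 𝓞 K, ‖φ (algebraMap (𝓞 K) K a)‖ ≤ 1)

theorem exists_finset_span (w z : M.X) :
    ∃ s : Finset (M.X.presheaf.stalk z), M.idealAt w z = Ideal.span (s : Set _) := by
  have := M.regular z
  obtain ⟨s, hs⟩ := IsNoetherian.noetherian (M.idealAt w z)
  exact ⟨s, hs.symm⟩

theorem pointInt_eq_of_span (y : Points c φ) (w : M.X)
    (s : Finset (M.X.presheaf.stalk (M.center hφ y)))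
    (hs : M.idealAt w (M.center hφ y) = Ideal.span (s : Set _)) :
    M.pointInt 𝔭 hφ y w = -Real.log (s.sup fun a =>
      ‖(((Scheme.stalkClosedPointTo (M.extension hφ y)).hom a : intRing L) : L)‖₊ : ℝ≥0) /
        Real.log (Ideal.absNorm 𝔭.asIdeal) := by
  let σ : M.X.presheaf.stalk (M.center hφ y) →+* L :=
    (algebraMap (intRing L) L).comp (Scheme.stalkClosedPointTo (M.extension hφ y)).hom
  have h_sup := sSup_norm_span σ (fun a => (mem_intRing_iff _).1 (Subtype.prop _)) s
  rw [← hs] at h_sup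
  rw [pointInt]
  congr 3

theorem pointInt_eq_of_center_eq {z : M.X} {y : Points c φ} (hy : M.center hφ y = z) (w : M.X)
    (s : Finset (M.X.presheaf.stalk z)) (hs : M.idealAt w z = Ideal.span (s : Set _))
    (r : M.X.presheaf.stalk z → L)
    (hr : ∀ a ∈ s, ∃ (U : M.X.Opens) (hU : z ∈ U) (g : Γ(M.X, U)),
      (M.X.presheaf.germ U z hU).hom g = a ∧ r a = evalAt y.1 ((M.j.app U).hom g)) :
    M.pointInt 𝔭 hφ y w = -Real.log (s.sup fun a => ‖r a‖₊ : ℝ≥0) /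
        Real.log (Ideal.absNorm 𝔭.asIdeal) := by
  subst hy
  rw [M.pointInt_eq_of_span 𝔭 hφ y w s hs]
  congr 4
  refine Finset.sup_congr rfl fun a ha => ?_
  obtain ⟨U, hU, g, rfl, hg⟩ := hr a ha
  rw [hg, ← M.evalHom_extension hφ y hU]
  rfl

theorem eventually_pointInt_eq (x : KPoints c) {z : M.X} (hz : M.center hφ (x.toPoints φ) = z)
    (h : M.j (pt x.1) ⤳ z) (w : M.X) (s : Finset (M.X.presheaf.stalk z))
    (hs : M.idealAt w z = Ideal.span (s : Set _)) :
    ∀ᶠ y in 𝓝 (x.toPoints φ), M.pointInt 𝔭 hφ y w =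
      -Real.log (s.sup fun a => ‖stalkEval (germMap M.j h a) y‖₊ : ℝ≥0) /
        Real.log (Ideal.absNorm 𝔭.asIdeal) := by
  have h_rep : ∀ a ∈ s, ∀ᶠ y in 𝓝 (x.toPoints φ),
      ∃ (U : M.X.Opens) (hU : z ∈ U) (g : Γ(M.X, U)), (M.X.presheaf.germ U z hU).hom g = a ∧
        stalkEval (germMap M.j h a) y = evalAt y.1 ((M.j.app U).hom g) := by
    intro a _
    obtain ⟨U, hU, g, rfl⟩ := M.X.presheaf.exists_germ_eq a
    filter_upwards [eventually_stalkEval_eq (pt_toPoints x φ) (h.mem_open U.2 hU)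
      (germMap_germ h hU g).symm] with y hy
    exact ⟨U, hU, g, rfl, hy⟩
  filter_upwards [M.eventually_center_eq (x.toPoints φ) hφ,
    (Filter.eventually_all_finset s).2 h_rep] with y hy hr
  exact M.pointInt_eq_of_center_eq 𝔭 hφ (hy.trans hz) w s hs _ hr

end RegularModel

section Length

theorem length_quotient_ker_sup {O A : Type*} [CommRing O] [CommRing A] {σ : O →+* A}
    (hσ : Function.Surjective σ) (I : Ideal O) :
    Module.length O (O ⧸ (RingHom.ker σ ⊔ I)) = Module.length A (A ⧸ I.map σ) := by
  let := σ.toAlgebra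
  let f : O →ₐ[O] A ⧸ I.map σ := Algebra.ofId O _
  have hf : Function.Surjective f := Ideal.Quotient.mk_surjective.comp hσ
  have h_ker : RingHom.ker σ ⊔ I = RingHom.ker f := by
    rw [sup_comm, RingHom.ker_eq_comap_bot, ← Ideal.comap_map_of_surjective σ hσ]
    ext g
    exact (Ideal.Quotient.eq_zero_iff_mem (I := I.map σ)).symm
  rw [h_ker, (Ideal.quotientKerAlgEquivOfSurjective hf).toLinearEquiv.length_eq]
  exact Module.length_eq_of_surjective (R := A) (S := O) hσ

variable {F : Type*} [Field F] {v : Valuation F (WithZero (Multiplicative ℤ))}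

theorem ord_valuationSubring_eq_one {π : v.valuationSubring}
    (hπ : v π = WithZero.exp (-1)) : Ring.ord v.valuationSubring π = 1 := by
  have h_max : Ideal.span {π} = maximalIdeal v.valuationSubring := by
    ext a
    rw [Ideal.mem_span_singleton, v.mem_maximalIdeal_iff,
      ← (Valuation.valuationSubring.integers v).le_iff_dvd, ← WithZero.exp_zero,
      ← neg_add_cancel (1 : ℤ), WithZero.exp_add, WithZero.lt_mul_exp_iff_le WithZero.exp_ne_zero,
      ← hπ]
    rfl
  rw [Ring.ord, h_max, Module.length_eq_one_iff]
  exact isSimpleModule_iff_isCoatom.2 (Ideal.isMaximal_def.1 (maximalIdeal.isMaximal _))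

theorem ord_valuationSubring (hv : ∃ π, v π = WithZero.exp (-1)) {n : ℕ} {a : v.valuationSubring}
    (ha : v a = WithZero.exp (-n : ℤ)) : Ring.ord v.valuationSubring a = n := by
  obtain ⟨π₀, hπ₀⟩ := hv
  let π : v.valuationSubring := ⟨π₀, hπ₀.trans_le (WithZero.exp_le_exp.2 (by norm_num))⟩
  have hπ_ne : π ≠ 0 := fun h => WithZero.exp_ne_zero
    (hπ₀.symm.trans ((v.zero_iff).2 (congrArg Subtype.val h)))
  have hπ_pow : v (π ^ n : v.valuationSubring) = v a := by
    rw [ha, SubmonoidClass.coe_pow, map_pow, hπ₀, ← WithZero.exp_nsmul, nsmul_eq_mul, mul_neg_one]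
  have h_assoc : Associated a (π ^ n) := associated_of_dvd_dvd
    ((Valuation.valuationSubring.integers v).dvd_of_le hπ_pow.le)
    ((Valuation.valuationSubring.integers v).dvd_of_le hπ_pow.ge)
  rw [Ring.ord_eq_of_associated h_assoc, Ring.ord_pow (mem_nonZeroDivisors_of_ne_zero hπ_ne),
    ord_valuationSubring_eq_one hπ₀, nsmul_one]

end Length

namespace RegularModel

variable {K : Type u} [Field K] [NumberField K] {C : Scheme.{u}} {c : C ⟶ Spec (.of K)}
  (M : RegularModel c) (𝔭 : HeightOneSpectrum (𝓞 K)) (x : KPoints c) {z : M.X}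

theorem idealAt_eq_top {y z : M.X} (h : ¬ y ⤳ z) : M.idealAt y z = ⊤ := dif_neg h

theorem exists_fromSpecStalk_eq {y z : M.X} (h : y ⤳ z) : ∃ P : Spec (M.X.presheaf.stalk z),
    P.asIdeal = M.idealAt y z ∧ M.X.fromSpecStalk z P = y := by
  refine ⟨Spec.map (M.X.presheaf.stalkSpecializes h) (closedPoint (M.X.presheaf.stalk y)), ?_, ?_⟩
  · rw [idealAt, dif_pos h]
    rfl
  · exact congr($(Scheme.SpecMap_stalkSpecializes_fromSpecStalk h) (closedPoint _)).trans
      Scheme.fromSpecStalk_closedPoint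

variable {M} in
theorem specializes_of_idealAt_le {w y : M.X} (hw : w ⤳ z) (hy : y ⤳ z)
    (h_le : M.idealAt w z ≤ M.idealAt y z) : w ⤳ y := by
  obtain ⟨P, hP, rfl⟩ := M.exists_fromSpecStalk_eq hw
  obtain ⟨Q, hQ, rfl⟩ := M.exists_fromSpecStalk_eq hy
  refine Specializes.map ?_ (M.X.fromSpecStalk z).continuous
  exact (PrimeSpectrum.le_iff_specializes P Q).1 (hP.trans_le (h_le.trans_eq hQ.symm))

theorem log_absNorm_pos : 0 < Real.log (Ideal.absNorm 𝔭.asIdeal) :=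
  Real.log_pos (by exact_mod_cast NumberField.HeightOneSpectrum.one_lt_absNorm 𝔭)

theorem localInt_eq_zero {y w z : M.X} (h : ¬ y ⤳ z) : M.localInt y w z = 0 := by
  rw [localInt, M.idealAt_eq_top h, top_sup_eq, Module.length_eq_zero, ENat.toNat_zero]

theorem intNum_comm (y w : M.X) : M.intNum 𝔭 y w = M.intNum 𝔭 w y := by
  have h_comm : ∀ z, M.localInt y w z = M.localInt w y z := fun z => by
    rw [localInt, sup_comm, ← localInt]
  simp only [intNum, h_comm]

variable {M 𝔭}

-- The values at `x` of the germs at `z` form the valuation ring of `𝔭`, and the kernel of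
-- `valueAt x h` is the ideal of the closure of `x`.
theorem localInt_eq (h : M.j (pt x.1) ⤳ z) (hz : M.f z = primePt 𝔭) {w : M.X} {n : ℕ}
    {a₀ : M.X.presheaf.stalk z} (ha₀ : a₀ ∈ M.idealAt w z)
    (h_val : 𝔭.valuation K (valueAt x h a₀) = WithZero.exp (-n : ℤ))
    (h_max : ∀ a ∈ M.idealAt w z,
      𝔭.valuation K (valueAt x h a) ≤ 𝔭.valuation K (valueAt x h a₀)) :
    M.localInt (M.j (pt x.1)) w z = n := by
  let A := (𝔭.valuation K).valuationSubring
  let σ : M.X.presheaf.stalk z →+* A :=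
    (valueAt x h).codRestrict A (valuation_valueAt_le_one x h hz)
  have hσ : Function.Surjective σ := fun a =>
    (exists_valueAt_eq x h hz a.2).imp fun g hg => Subtype.ext hg
  have h_ker : M.idealAt (M.j (pt x.1)) z = RingHom.ker σ := by
    ext a
    rw [mem_idealAt_iff, RingHom.mem_ker, Subtype.ext_iff]
    rfl
  have h_map : (M.idealAt w z).map σ = Ideal.span {σ a₀} := by
    refine le_antisymm (Ideal.map_le_iff_le_comap.2 fun a ha => ?_)
      ((Ideal.span_singleton_le_iff_mem _).2 (Ideal.mem_map_of_mem σ ha₀))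
    exact Ideal.mem_span_singleton.2
      ((Valuation.valuationSubring.integers (𝔭.valuation K)).dvd_of_le (h_max a ha))
  rw [localInt, h_ker, length_quotient_ker_sup hσ, h_map]
  exact congrArg ENat.toNat (ord_valuationSubring (𝔭.valuation_exists_uniformizer K) h_val)

end RegularModel

theorem exists_ne_zero_forall_valuation_le {ι F Γ₀ : Type*} [Field F]
    [LinearOrderedCommGroupWithZero Γ₀] (v : Valuation F Γ₀) {s : Finset ι} {g : ι → F}
    (hg : ∃ a ∈ s, g a ≠ 0) : ∃ a₀ ∈ s, g a₀ ≠ 0 ∧ ∀ a ∈ s, v (g a) ≤ v (g a₀) := by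
  obtain ⟨a₁, ha₁, h_ne⟩ := hg
  obtain ⟨a₀, ha₀, h_max⟩ := s.exists_max_image (fun a => v (g a)) ⟨a₁, ha₁⟩
  refine ⟨a₀, ha₀, fun h₀ => h_ne ?_, h_max⟩
  simpa only [h₀, map_zero, le_zero_iff, map_eq_zero] using h_max a₁ ha₁

namespace RegularModel

variable {K : Type u} [Field K] [NumberField K] {C : Scheme.{u}} {c : C ⟶ Spec (.of K)}
  {M : RegularModel c} {𝔭 : HeightOneSpectrum (𝓞 K)} (x : KPoints c) {z : M.X}
  (h : M.j (pt x.1) ⤳ z) (hz : M.f z = primePt 𝔭)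

theorem not_idealAt_le {w y : M.X} (hy : y ⤳ z) (hw : ¬ w ⤳ y) :
    ¬ M.idealAt w z ≤ M.idealAt y z := by
  intro h_le
  by_cases hwz : w ⤳ z
  · exact hw (specializes_of_idealAt_le hwz hy h_le)
  · obtain ⟨P, hP, -⟩ := M.exists_fromSpecStalk_eq hy
    rw [M.idealAt_eq_top hwz, ← hP, top_le_iff] at h_le
    exact P.2.ne_top h_le

include hz in
theorem exists_germMap_eq_mul_of_mem_span {γ : WithZero (Multiplicative ℤ)}
    {u : C.presheaf.stalk (pt x.1)} {s : Finset (M.X.presheaf.stalk z)}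
    {q : M.X.presheaf.stalk z → C.presheaf.stalk (pt x.1)}
    (hq : ∀ a ∈ s, germMap M.j h a = u * q a) (h_le : ∀ a ∈ s, 𝔭.valuation K (x.ev (q a)) ≤ γ)
    {a : M.X.presheaf.stalk z} (ha : a ∈ Ideal.span (s : Set (M.X.presheaf.stalk z))) :
    ∃ e, germMap M.j h a = u * e ∧ 𝔭.valuation K (x.ev e) ≤ γ := by
  induction ha using Submodule.span_induction with
  | mem a ha => exact ⟨q a, hq a ha, h_le a ha⟩
  | zero =>
    refine ⟨0, by rw [map_zero, mul_zero], ?_⟩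
    rw [map_zero, map_zero]
    exact zero_le
  | add a b _ _ ha hb =>
    obtain ⟨e, he, he_le⟩ := ha
    obtain ⟨e', he', he'_le⟩ := hb
    refine ⟨e + e', by rw [map_add, he, he', mul_add], ?_⟩
    rw [map_add]
    exact (Valuation.map_add _ _ _).trans (max_le he_le he'_le)
  | smul a b _ hb =>
    obtain ⟨e, he, he_le⟩ := hb
    refine ⟨germMap M.j h a * e, by rw [smul_eq_mul, map_mul, he, mul_left_comm], ?_⟩
    rw [map_mul, map_mul]
    exact (mul_le_of_le_one_left' (valuation_valueAt_le_one x h hz a)).trans he_le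

include hz in
theorem exists_forall_valuation_valueAt_le {s : Finset (M.X.presheaf.stalk z)}
    (hs : ¬ Ideal.span (s : Set (M.X.presheaf.stalk z)) ≤ M.idealAt (M.j (pt x.1)) z) :
    ∃ a₀ ∈ s, valueAt x h a₀ ≠ 0 ∧ ∀ a ∈ Ideal.span (s : Set (M.X.presheaf.stalk z)),
      𝔭.valuation K (valueAt x h a) ≤ 𝔭.valuation K (valueAt x h a₀) := by
  have h_ne : ∃ a ∈ s, valueAt x h a ≠ 0 := by
    by_contra! h_zero
    exact hs (Ideal.span_le.2 fun a ha => (mem_idealAt_iff x h a).2 (h_zero a ha))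
  obtain ⟨a₀, ha₀, h_ne, h_max⟩ := exists_ne_zero_forall_valuation_le (𝔭.valuation K) h_ne
  refine ⟨a₀, ha₀, h_ne, fun a ha => ?_⟩
  obtain ⟨e, he, h_le⟩ :=
    exists_germMap_eq_mul_of_mem_span x h hz (fun a _ => (one_mul (germMap M.j h a)).symm) h_max ha
  rw [one_mul] at he
  rwa [← he] at h_le

include hz in
theorem exists_valuation_valueAt_eq_exp_neg {a : M.X.presheaf.stalk z} (ha : valueAt x h a ≠ 0) :
    ∃ n : ℕ, 𝔭.valuation K (valueAt x h a) = WithZero.exp (-n : ℤ) := by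
  have h_ne : 𝔭.valuation K (valueAt x h a) ≠ 0 := (map_ne_zero _).2 ha
  have h_le := valuation_valueAt_le_one x h hz a
  rw [← WithZero.exp_log h_ne, ← WithZero.exp_zero, WithZero.exp_le_exp] at h_le
  refine ⟨(-WithZero.log (𝔭.valuation K (valueAt x h a))).toNat, ?_⟩
  rw [Int.toNat_of_nonneg (by lia), neg_neg, WithZero.exp_log h_ne]

include h hz in
theorem eq_of_j_pt_specializes {z' : M.X} (h' : M.j (pt x.1) ⤳ z') (hz' : M.f z' = primePt 𝔭) :
    z' = z :=
  (M.eq_center (norm_toCp_le_one K 𝔭) (norm_toCp K 𝔭) x h' hz').trans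
    (M.eq_center (norm_toCp_le_one K 𝔭) (norm_toCp K 𝔭) x h hz).symm

include h hz in
theorem intNum_eq_localInt (w : M.X) :
    M.intNum 𝔭 (M.j (pt x.1)) w = M.localInt (M.j (pt x.1)) w z := by
  have h_zero : ∀ z' ∈ {z : M.X | M.f z = primePt 𝔭}, z' ≠ z →
      (M.localInt (M.j (pt x.1)) w z' * M.f.residueDegree z' : ℚ) = 0 := by
    intro z' hz' h_ne
    rw [M.localInt_eq_zero fun h' => h_ne (eq_of_j_pt_specializes x h hz h' hz'), Nat.cast_zero,
      zero_mul]
  rw [intNum, finsum_mem_inter_support_eq _ _ {z}, finsum_mem_singleton,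
    residueDegree_eq_one x h hz, Nat.cast_one, mul_one]
  ext z'
  simp only [Set.mem_inter_iff, Function.mem_support, Set.mem_singleton_iff]
  exact and_congr_left fun h_supp =>
    ⟨fun hz' => by_contra fun h_ne => h_supp (h_zero z' hz' h_ne), fun h_eq => h_eq ▸ hz⟩

end RegularModel

section StalkEvalLimit

variable {K : Type u} [Field K] [NumberField K] {C : Scheme.{u}} {c : C ⟶ Spec (.of K)}
  {𝔭 : HeightOneSpectrum (𝓞 K)} {L : Type u} [NormedField L] {φ : K →+* L}
  (hn : ∀ a : K, ‖φ a‖ = NumberField.HeightOneSpectrum.adicAbv K 𝔭 a) (x : KPoints c)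
  {ι : Type*} {s : Finset ι} {e : ι → C.presheaf.stalk (pt x.1)} {a₀ : ι} (ha₀ : a₀ ∈ s)
  (h_max : ∀ a ∈ s, 𝔭.valuation K (x.ev (e a)) ≤ 𝔭.valuation K (x.ev (e a₀)))

include hn ha₀ h_max

theorem tendsto_sup_nnnorm_stalkEval :
    Filter.Tendsto (fun y => s.sup fun a => ‖stalkEval (e a) y‖₊)
      (𝓝 (x.toPoints φ)) (𝓝 ‖φ (x.ev (e a₀))‖₊) := by
  have h_sup : s.sup (fun a => ‖stalkEval (e a) (x.toPoints φ)‖₊) = ‖φ (x.ev (e a₀))‖₊ := by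
    simp only [stalkEval_toPoints]
    exact le_antisymm (Finset.sup_le fun a ha => (norm_le_norm_iff hn _ _).2 (h_max a ha))
      (Finset.le_sup (f := fun a => ‖φ (x.ev (e a))‖₊) ha₀)
  rw [← h_sup]
  exact Filter.Tendsto.finset_sup_nhds_apply fun a _ =>
    (tendsto_stalkEval (pt_toPoints x φ) (e a)).nnnorm

theorem tendsto_log_sup_nnnorm_stalkEval {k : ℤ}
    (h_val : 𝔭.valuation K (x.ev (e a₀)) = WithZero.exp k) :
    Filter.Tendsto (fun y => Real.log (s.sup fun a => ‖stalkEval (e a) y‖₊ : ℝ≥0))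
      (𝓝 (x.toPoints φ)) (𝓝 (k * Real.log (Ideal.absNorm 𝔭.asIdeal))) := by
  have h_ne : x.ev (e a₀) ≠ 0 := (map_ne_zero _).1 (h_val ▸ WithZero.exp_ne_zero)
  rw [← log_norm hn h_val]
  exact Filter.Tendsto.log (NNReal.tendsto_coe.2 <| tendsto_sup_nnnorm_stalkEval hn x ha₀ h_max)
    (norm_ne_zero_iff.2 ((map_ne_zero φ).2 h_ne))

end StalkEvalLimit

namespace RegularModel

variable {K : Type u} [Field K] [NumberField K] {C : Scheme.{u}} {c : C ⟶ Spec (.of K)}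
  (M : RegularModel c) {𝔭 : HeightOneSpectrum (𝓞 K)} {L : Type u} [NormedField L]
  [IsUltrametricDist L] {φ : K →+* L} (hφ : ∀ a : 𝓞 K, ‖φ (algebraMap (𝓞 K) K a)‖ ≤ 1)
  (hn : ∀ a : K, ‖φ a‖ = NumberField.HeightOneSpectrum.adicAbv K 𝔭 a)

include hn in
theorem tendsto_pointInt (x : KPoints c) {w : M.X} (hw : ¬ w ⤳ M.j (pt x.1)) :
    Filter.Tendsto (fun y => M.pointInt 𝔭 hφ y w) (𝓝 (x.toPoints φ))
      (𝓝 (M.intNum 𝔭 (M.j (pt x.1)) w : ℝ)) := by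
  obtain ⟨z, h_center⟩ : ∃ z, M.center hφ (x.toPoints φ) = z := ⟨_, rfl⟩
  have h : M.j (pt x.1) ⤳ z := by
    simpa only [pt_toPoints, h_center] using M.j_specializes_center hφ (x.toPoints φ)
  have hz : M.f z = primePt 𝔭 := h_center ▸ M.f_center hφ hn _
  obtain ⟨s, hs⟩ := M.exists_finset_span w z
  obtain ⟨a₀, ha₀, h_ne, h_max⟩ :=
    exists_forall_valuation_valueAt_le x h hz (hs ▸ not_idealAt_le h hw)
  obtain ⟨n, h_val⟩ := exists_valuation_valueAt_eq_exp_neg x h hz h_ne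
  have h_int : M.intNum 𝔭 (M.j (pt x.1)) w = n := by
    rw [intNum_eq_localInt x h hz, localInt_eq x h hz (hs ▸ Ideal.subset_span ha₀) h_val
      (hs ▸ h_max)]
  have h_lim := (tendsto_log_sup_nnnorm_stalkEval hn x ha₀
    (fun a ha => h_max a (Ideal.subset_span ha)) h_val).neg.div_const
      (Real.log (Ideal.absNorm 𝔭.asIdeal))
  rw [h_int, Rat.cast_natCast]
  rw [Int.cast_neg, Int.cast_natCast, neg_mul, neg_neg,
    mul_div_cancel_right₀ _ (log_absNorm_pos 𝔭).ne'] at h_lim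
  exact h_lim.congr'
    ((M.eventually_pointInt_eq 𝔭 hφ x h_center h w s hs).mono fun y hy => hy.symm)

end RegularModel

section CotangentSpace

variable {A O : Type*} [CommRing A] [CommRing O] [IsLocalRing O] [Algebra A O] (ev : O →ₐ[A] A)
  (h_ker : RingHom.ker ev = maximalIdeal O)

include h_ker in
theorem sub_algebraMap_mem_maximalIdeal (e : O) : e - algebraMap A O (ev e) ∈ maximalIdeal O := by
  rw [← h_ker, RingHom.mem_ker, map_sub, ev.commutes, Algebra.algebraMap_self_apply, sub_self]

/-- The derivation `e ↦ [e - e(x)]` of a local algebra with values in its cotangent space, where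
`e(x) = ev e` is the value at a rational point `x` with maximal ideal as the kernel of `ev`. -/
def cotangentDerivation : Derivation A O (CotangentSpace O) :=
  Derivation.mk'
    { toFun := fun e => (maximalIdeal O).toCotangent
        ⟨e - algebraMap A O (ev e), sub_algebraMap_mem_maximalIdeal ev h_ker e⟩
      map_add' := fun e e' => by
        rw [← map_add]
        congr 1
        ext
        simp only [map_add, Submodule.coe_add]
        ring
      map_smul' := fun a e => by
        conv_rhs => rw [RingHom.id_apply, ← algebraMap_smul O a, ← map_smul]
        congr 1
        ext
        simp only [Algebra.smul_def, map_mul, ev.commutes, Algebra.algebraMap_self_apply,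
          Submodule.coe_smul]
        ring }
    fun e e' => by
      have h_sq := Ideal.mul_mem_mul (sub_algebraMap_mem_maximalIdeal ev h_ker e)
        (sub_algebraMap_mem_maximalIdeal ev h_ker e')
      rw [← pow_two, ← Ideal.neg_mem_iff] at h_sq
      simp only [LinearMap.coe_mk, AddHom.coe_mk]
      rw [← map_smul, ← map_smul, ← map_add, Ideal.toCotangent_eq]
      convert h_sq using 1
      simp only [Submodule.coe_smul, Submodule.coe_add, smul_eq_mul, map_mul]
      ring

theorem cotangentDerivation_of_mem (e : maximalIdeal O) :
    cotangentDerivation ev h_ker e = (maximalIdeal O).toCotangent e := by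
  have h_zero : ev e = 0 := by
    rw [← RingHom.mem_ker, h_ker]
    exact e.2
  refine congrArg (maximalIdeal O).toCotangent (Subtype.ext ?_)
  change (e : O) - algebraMap A O (ev e) = e
  rw [h_zero, map_zero, sub_zero]

include h_ker in
theorem isPrincipal_maximalIdeal_of_kaehlerDifferential [IsNoetherianRing O]
    (h_top : (⊤ : Submodule O Ω[O⁄A]).IsPrincipal) : (maximalIdeal O).IsPrincipal := by
  obtain ⟨ω, hω⟩ := h_top
  rw [← finrank_cotangentSpace_le_one_iff]
  let D := cotangentDerivation ev h_ker
  refine finrank_le_one (D.liftKaehlerDifferential ω) fun v => ?_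
  obtain ⟨e, rfl⟩ := (maximalIdeal O).toCotangent_surjective v
  obtain ⟨a, ha⟩ := Submodule.mem_span_singleton.1
    (hω ▸ Submodule.mem_top : KaehlerDifferential.D A O e ∈ _)
  refine ⟨residue O a, ?_⟩
  rw [← cotangentDerivation_of_mem ev h_ker, ← D.liftKaehlerDifferential_comp_D, ← ha, map_smul]
  rfl

end CotangentSpace

theorem maximalIdeal_eq_span_of_notMem_sq {O : Type*} [CommRing O] [IsLocalRing O]
    (h_prin : (maximalIdeal O).IsPrincipal) {u : O} (hu : u ∈ maximalIdeal O)
    (hu_sq : u ∉ maximalIdeal O ^ 2) : maximalIdeal O = Ideal.span {u} := by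
  obtain ⟨π, hπ⟩ := h_prin
  have hπ_mem : π ∈ maximalIdeal O := hπ ▸ Submodule.mem_span_singleton_self π
  obtain ⟨a, rfl⟩ := Submodule.mem_span_singleton.1 (hπ ▸ hu)
  have ha : IsUnit a := by
    by_contra h_mem
    exact hu_sq (pow_two (maximalIdeal O) ▸ Ideal.mul_mem_mul h_mem hπ_mem)
  rw [smul_eq_mul, mul_comm, Ideal.span_singleton_mul_right_unit ha]
  exact hπ

theorem isPrincipal_top_kaehlerDifferential_of_isLocalization {A B : Type*} (O : Type*)
    [CommRing A] [CommRing B] [CommRing O] [Algebra A B] [Algebra B O] [Algebra A O]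
    [IsScalarTower A B O] (S : Submonoid B) [IsLocalization S O]
    (h_top : (⊤ : Submodule B Ω[B⁄A]).IsPrincipal) : (⊤ : Submodule O Ω[O⁄A]).IsPrincipal := by
  obtain ⟨ω, hω⟩ := h_top
  refine ⟨KaehlerDifferential.map A A B O ω, top_le_iff.1 ?_ |>.symm⟩
  rw [← KaehlerDifferential.span_range_map_derivation_of_isLocalization A B O S, Submodule.span_le]
  rintro _ ⟨b, rfl⟩
  obtain ⟨b', hb'⟩ := Submodule.mem_span_singleton.1
    (hω ▸ Submodule.mem_top : KaehlerDifferential.D A B b ∈ _)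
  rw [Function.comp_apply, ← hb', map_smul, ← algebraMap_smul O b']
  exact Submodule.smul_mem _ _ (Submodule.mem_span_singleton_self _)

section SmoothCurve

theorem isPrincipal_top_kaehlerDifferential_of_isStandardSmooth (A B : Type*) [CommRing A]
    [CommRing B] [Nontrivial B] [Algebra A B]
    [Algebra.IsStandardSmoothOfRelativeDimension 1 A B] :
    (⊤ : Submodule B Ω[B⁄A]).IsPrincipal := by
  have := Algebra.IsStandardSmoothOfRelativeDimension.isStandardSmooth (R := A) (S := B) 1
  have h_rank := Algebra.IsStandardSmoothOfRelativeDimension.rank_kaehlerDifferential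
    (R := A) (S := B) 1
  obtain ⟨b⟩ := (finrank_eq_one_iff (K := B) (V := Ω[B⁄A]) Unit).1
    (Module.finrank_eq_of_rank_eq h_rank)
  exact ⟨b (), by rw [← b.span_eq, Set.range_unique]⟩

variable {K : Type u} [Field K] {C : Scheme.{u}} {c : C ⟶ Spec (.of K)}
  (hc : SmoothOfRelativeDimension 1 c) (x : KPoints c)

include hc

theorem isLocallyNoetherian_of_smooth : IsLocallyNoetherian C := by
  have := hc.smooth
  exact LocallyOfFiniteType.isLocallyNoetherian c

theorem isPrincipal_maximalIdeal_of_smooth :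
    (maximalIdeal (C.presheaf.stalk (pt x.1))).IsPrincipal := by
  have := isLocallyNoetherian_of_smooth hc
  obtain ⟨U, -, V, hV, hxV, h_le, h_std⟩ :=
    hc.exists_isStandardSmoothOfRelativeDimension (pt x.1)
  obtain rfl : U = ⊤ := top_le_iff.1 fun y _ =>
    (Subsingleton.elim (α := PrimeSpectrum K) (c (pt x.1)) y) ▸ h_le hxV
  let A := Γ(Spec (.of K), ⊤)
  let O := C.presheaf.stalk (pt x.1)
  let germ := C.presheaf.germ V (pt x.1) hxV
  let := (c.appLE ⊤ V h_le).hom.toAlgebra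
  let : Algebra Γ(C, V) O := germ.hom.toAlgebra
  let : Algebra A O := (germ.hom.comp (c.appLE ⊤ V h_le).hom).toAlgebra
  have : IsScalarTower A Γ(C, V) O := IsScalarTower.of_algebraMap_eq' rfl
  have : Algebra.IsStandardSmoothOfRelativeDimension 1 A Γ(C, V) := h_std
  have : Nontrivial Γ(C, V) := germ.hom.domain_nontrivial
  have := hV.isLocalization_stalk ⟨pt x.1, hxV⟩
  let ev : O →ₐ[A] A :=
    { __ := (Scheme.ΓSpecIso (.of K)).inv.hom.comp x.ev
      commutes' := fun a => by
        obtain ⟨b, rfl⟩ : ∃ b, (Scheme.ΓSpecIso (.of K)).inv.hom b = a :=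
          ⟨_, congr($((Scheme.ΓSpecIso (.of K)).hom_inv_id).hom a)⟩
        exact congrArg (Scheme.ΓSpecIso (.of K)).inv.hom (x.evalHom_constants hxV b) }
  refine isPrincipal_maximalIdeal_of_kaehlerDifferential ev ?_
    (isPrincipal_top_kaehlerDifferential_of_isLocalization O
      (hV.primeIdealOf ⟨pt x.1, hxV⟩).asIdeal.primeCompl
      (isPrincipal_top_kaehlerDifferential_of_isStandardSmooth A Γ(C, V)))
  ext e
  rw [← x.ev_eq_zero_iff]
  exact map_eq_zero_iff (Scheme.ΓSpecIso (.of K)).inv.hom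
    (ConcreteCategory.injective_of_mono_of_preservesPullback _)

theorem exists_finset_ker_evalHom_eq_span {U : C.Opens} (hU : IsAffineOpen U)
    (hxU : pt x.1 ∈ U) :
    ∃ s : Finset Γ(C, U), RingHom.ker (evalHom x.1 U hxU) = Ideal.span (s : Set Γ(C, U)) := by
  have := isLocallyNoetherian_of_smooth hc
  have h_noeth : IsNoetherianRing Γ(C, U) := IsLocallyNoetherian.component_noetherian ⟨U, hU⟩
  exact ((isNoetherianRing_iff_ideal_fg _).1 h_noeth _).imp fun s hs => hs.symm

variable {L : Type u} [NormedField L] {φ : K →+* L}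

omit hc in
theorem eq_toPoints_of_ker_le {U : C.Opens} (hU : IsAffineOpen U) (hxU : pt x.1 ∈ U)
    {y : Points c φ} (hyU : pt y.1 ∈ U)
    (h_le : RingHom.ker (evalHom x.1 U hxU) ≤ RingHom.ker (evalHom y.1 U hyU)) :
    y = x.toPoints φ := by
  have hxU' : pt (x.toPoints φ).1 ∈ U := (pt_toPoints x φ).symm ▸ hxU
  have h_eval : evalHom y.1 U hyU = evalHom (x.toPoints φ).1 U hxU' := by
    ext b
    have h_sub : b - constants c U (evalHom x.1 U hxU b) ∈ RingHom.ker (evalHom x.1 U hxU) := by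
      rw [RingHom.mem_ker, map_sub, x.evalHom_constants, sub_self]
    have h_zero := h_le h_sub
    rw [RingHom.mem_ker, map_sub, evalHom_constants c y.1 φ y.2 hyU, sub_eq_zero] at h_zero
    exact h_zero.trans (evalHom_specMap_comp φ x.1 hxU hxU' b).symm
  refine Subtype.ext ?_
  rw [← specMap_evalHom_fromSpec y.1 hU hyU, h_eval, specMap_evalHom_fromSpec _ hU hxU']

theorem eventually_stalkEval_ne_zero {u : C.presheaf.stalk (pt x.1)}
    (hu : maximalIdeal (C.presheaf.stalk (pt x.1)) = Ideal.span {u}) :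
    ∀ᶠ y in 𝓝[≠] (x.toPoints φ), stalkEval u y ≠ 0 := by
  obtain ⟨_, ⟨U, hU, rfl⟩, hxU, -⟩ := C.isBasis_affineOpens.exists_subset_of_mem_open
    (Set.mem_univ (pt x.1)) isOpen_univ
  obtain ⟨s, hs⟩ := exists_finset_ker_evalHom_eq_span hc x hU hxU
  have h_eval : ∀ b ∈ s, ∀ᶠ y in 𝓝 (x.toPoints φ), stalkEval u y = 0 → evalAt y.1 b = 0 := by
    intro b hb
    have h_mem : x.ev ((C.presheaf.germ U _ hxU).hom b) = 0 := by
      have h_ker : b ∈ RingHom.ker (evalHom x.1 U hxU) := hs ▸ Ideal.subset_span hb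
      exact h_ker
    rw [x.ev_eq_zero_iff, hu, Ideal.mem_span_singleton] at h_mem
    obtain ⟨e, he⟩ := h_mem
    filter_upwards [eventually_stalkEval_mul (pt_toPoints x φ) u e,
      eventually_stalkEval_eq (pt_toPoints x φ) hxU he] with y h_mul h_eq hy
    rw [← h_eq, h_mul, hy, zero_mul]
  rw [eventually_nhdsWithin_iff]
  filter_upwards [(Filter.eventually_all_finset s).2 h_eval,
    eventually_pt_mem (x.toPoints φ) ((pt_toPoints x φ).symm ▸ hxU)] with y hy hyU h_ne h_zero
  refine h_ne (eq_toPoints_of_ker_le x hU hxU hyU ?_)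
  rw [hs]
  exact Ideal.span_le.2 fun b hb => (evalAt_eq_evalHom y.1 hyU b).symm.trans (hy b hb h_zero)

end SmoothCurve

section GenericPt

variable {K : Type u} [Field K]

variable (K) in
/-- The generic point of `Spec 𝓞_K`, as the image of the point of `Spec K`. -/
def genericPt : Spec (.of (𝓞 K)) :=
  Spec.map (CommRingCat.ofHom (algebraMap (𝓞 K) K)) (closedPoint K)

theorem genericPt_asIdeal : PrimeSpectrum.asIdeal (genericPt K) = ⊥ := by
  refine eq_bot_iff.2 fun a ha => ?_
  have ha' : algebraMap (𝓞 K) K a ∈ maximalIdeal K := ha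
  rw [maximalIdeal_eq_bot, Ideal.mem_bot] at ha'
  exact (FaithfulSMul.algebraMap_eq_zero_iff (𝓞 K) K).1 ha'

theorem primePt_ne_genericPt [NumberField K] (𝔭 : HeightOneSpectrum (𝓞 K)) :
    primePt 𝔭 ≠ genericPt K :=
  fun h => 𝔭.ne_bot ((congrArg PrimeSpectrum.asIdeal h).trans genericPt_asIdeal)

end GenericPt

namespace RegularModel

variable {K : Type u} [Field K] [NumberField K] {C : Scheme.{u}} {c : C ⟶ Spec (.of K)}
  (M : RegularModel c)

instance flat_j : Flat M.j := by
  have : Flat (Spec.map (CommRingCat.ofHom (algebraMap (𝓞 K) K))) := by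
    rw [Flat.SpecMap_iff]
    have : IsLocalization (nonZeroDivisors (𝓞 K)) K := inferInstanceAs (IsFractionRing (𝓞 K) K)
    exact RingHom.flat_algebraMap_iff.2 (IsLocalization.flat K (nonZeroDivisors (𝓞 K)))
  exact MorphismProperty.of_isPullback M.isPullback.flip this

instance isPreimmersion_j : IsPreimmersion M.j := by
  have : IsLocalization (nonZeroDivisors (𝓞 K)) K := inferInstanceAs (IsFractionRing (𝓞 K) K)
  have : IsPreimmersion (Spec.map (CommRingCat.ofHom (algebraMap (𝓞 K) K))) :=
    IsPreimmersion.of_isLocalization (R := 𝓞 K) (S := K) (nonZeroDivisors (𝓞 K))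
  exact MorphismProperty.of_isPullback M.isPullback.flip this

include M in
theorem isSeparated_c : IsSeparated c := by
  have := M.isProper
  exact MorphismProperty.of_isPullback M.isPullback inferInstance

theorem f_j (x : C) : M.f (M.j x) = genericPt K := by
  rw [← Scheme.Hom.comp_apply, M.isPullback.w, Scheme.Hom.comp_apply, genericPt]
  congr 1
  exact Subsingleton.elim (α := PrimeSpectrum K) _ _

theorem mem_range_j_iff (y : M.X) : y ∈ Set.range M.j ↔ M.f y = genericPt K := by
  refine ⟨?_, fun h => ?_⟩
  · rintro ⟨x, rfl⟩
    exact M.f_j x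
  · exact (Scheme.exists_preimage_of_isPullback M.isPullback.flip (closedPoint K) y h.symm).imp
      fun x hx => hx.2

include M in
theorem isClosed_pt (x : KPoints c) : IsClosed {pt x.1} := by
  have := M.isSeparated_c
  have : IsClosedImmersion (x.1 ≫ c) := by rw [x.2]; infer_instance
  have := IsClosedImmersion.of_comp x.1 c
  have : Subsingleton (Spec (.of K)) := inferInstanceAs (Subsingleton (PrimeSpectrum K))
  have h_range : Set.range x.1 = {pt x.1} :=
    Set.range_eq_singleton_iff.2 fun a => congrArg x.1 (Subsingleton.elim a _)
  exact h_range ▸ x.1.isClosedEmbedding.isClosed_range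

theorem j_specializes_iff {x y : C} : M.j x ⤳ M.j y ↔ x ⤳ y :=
  M.j.isEmbedding.isInducing.specializes_iff

theorem eq_of_j_specializes (x : KPoints c) {y : C} (h : M.j (pt x.1) ⤳ M.j y) : y = pt x.1 :=
  (M.j_specializes_iff.1 h).mem_closed (M.isClosed_pt x) rfl

theorem stalkMap_j_bijective (x : C) : Function.Bijective (M.j.stalkMap x).hom := by
  refine ⟨?_, M.j.stalkMap_surjective x⟩
  algebraize [(M.j.stalkMap x).hom]
  have : Module.Flat (M.X.presheaf.stalk (M.j x)) (C.presheaf.stalk x) := Flat.stalkMap M.j x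
  have : IsLocalHom (algebraMap (M.X.presheaf.stalk (M.j x)) (C.presheaf.stalk x)) :=
    inferInstanceAs (IsLocalHom (M.j.stalkMap x).hom)
  have : Module.FaithfullyFlat (M.X.presheaf.stalk (M.j x)) (C.presheaf.stalk x) :=
    Module.FaithfullyFlat.of_flat_of_isLocalHom
  exact FaithfulSMul.algebraMap_injective (M.X.presheaf.stalk (M.j x)) (C.presheaf.stalk x)

theorem coheight_j_le_one (hc : SmoothOfRelativeDimension 1 c) (x : KPoints c) :
    Order.coheight (M.j (pt x.1)) ≤ 1 := by
  have := isLocallyNoetherian_of_smooth hc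
  have := isPrincipal_maximalIdeal_of_smooth hc x
  have h_dim := ringKrullDim_eq_of_ringEquiv
    (RingEquiv.ofBijective _ (M.stalkMap_j_bijective (pt x.1)))
  rw [ringKrullDim_stalk_eq_coheight, ← IsLocalRing.maximalIdeal_height_eq_ringKrullDim] at h_dim
  rw [WithBot.coe_injective h_dim]
  refine Ideal.height_le_one_of_isPrincipal_of_mem_minimalPrimes
    (maximalIdeal (C.presheaf.stalk (pt x.1))) _ ?_
  rw [Ideal.minimalPrimes_eq_subsingleton_self]
  rfl

theorem coheight_j_eq_one (hc : SmoothOfRelativeDimension 1 c) {x y : KPoints c}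
    (hxy : pt x.1 ≠ pt y.1) : Order.coheight (M.j (pt x.1)) = 1 := by
  have := M.isIntegral
  refine le_antisymm (M.coheight_j_le_one hc x) (Order.one_le_iff_pos.2 ?_)
  rw [Order.coheight_pos]
  intro h_max
  have h_generic : M.j (pt x.1) ⤳ genericPoint M.X :=
    h_max (genericPoint_specializes (M.j (pt x.1)))
  exact hxy (M.eq_of_j_specializes x (h_generic.trans (genericPoint_specializes _))).symm

end RegularModel

section Differential

variable {K : Type u} [Field K] {C : Scheme.{u}} {c : C ⟶ Spec (.of K)}

theorem differential_of_mem {x : C} {u : C.presheaf.stalk x}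
    (hu : u ∈ maximalIdeal (C.presheaf.stalk x)) :
    differential c x u = (maximalIdeal (C.presheaf.stalk x)).toCotangent ⟨u, hu⟩ :=
  dif_pos hu

theorem differential_ne_zero_iff {x : C} {u : C.presheaf.stalk x}
    (hu : u ∈ maximalIdeal (C.presheaf.stalk x)) :
    differential c x u ≠ 0 ↔ u ∉ maximalIdeal (C.presheaf.stalk x) ^ 2 := by
  rw [differential_of_mem hu]
  exact not_congr (Ideal.toCotangent_eq_zero _ _)

theorem differential_mul (x : KPoints c) {u : C.presheaf.stalk (pt x.1)}
    (hu : u ∈ maximalIdeal (C.presheaf.stalk (pt x.1))) (e : C.presheaf.stalk (pt x.1)) :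
    differential c _ (u * e) = x.ev e • differential c _ u := by
  rw [differential_of_mem (Ideal.mul_mem_right e _ hu), differential_of_mem hu]
  change _ = (scalars c (pt x.1) (x.ev e)) •
    (maximalIdeal (C.presheaf.stalk (pt x.1))).toCotangent ⟨u, hu⟩
  have h_sub : e - scalars c _ (x.ev e) ∈ maximalIdeal (C.presheaf.stalk (pt x.1)) := by
    rw [← x.ev_eq_zero_iff, map_sub, x.ev_scalars, sub_self]
  have h_sq := Ideal.mul_mem_mul hu h_sub
  rw [← pow_two] at h_sq
  rw [← map_smul, Ideal.toCotangent_eq]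
  convert h_sq using 1
  simp only [Submodule.coe_smul, smul_eq_mul]
  ring

end Differential

namespace RegularModel

variable {K : Type u} [Field K] [NumberField K] {C : Scheme.{u}} {c : C ⟶ Spec (.of K)}
  (M : RegularModel c) {𝔭 : HeightOneSpectrum (𝓞 K)}

theorem exists_isUnit_germMap_eq_mul {x : C} {z : M.X} (h : M.j x ⤳ z)
    (e : C.presheaf.stalk x) :
    ∃ (a : M.X.presheaf.stalk z) (t : C.presheaf.stalk x), IsUnit t ∧ germMap M.j h a = e * t := by
  obtain ⟨e', rfl⟩ := (M.stalkMap_j_bijective x).2 e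
  obtain ⟨_, ⟨W, hW, rfl⟩, hzW, -⟩ := M.X.isBasis_affineOpens.exists_subset_of_mem_open
    (Set.mem_univ z) isOpen_univ
  have hzW : z ∈ W := hzW
  have hxW : M.j x ∈ W := h.mem_open W.isOpen hzW
  let : Algebra Γ(M.X, W) (M.X.presheaf.stalk (M.j x)) := (M.X.presheaf.germ W _ hxW).hom.toAlgebra
  have := hW.isLocalization_stalk ⟨M.j x, hxW⟩
  obtain ⟨⟨b, s⟩, h_frac⟩ :=
    IsLocalization.surj (hW.primeIdealOf ⟨M.j x, hxW⟩).asIdeal.primeCompl e'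
  have hs := IsLocalization.map_units (M.X.presheaf.stalk (M.j x)) s
  refine ⟨(M.X.presheaf.germ W z hzW).hom b, _, hs.map (M.j.stalkMap x).hom, ?_⟩
  rw [← map_mul]
  refine Eq.trans ?_ (congrArg (M.j.stalkMap x).hom h_frac.symm)
  exact congrArg (M.j.stalkMap x).hom (M.X.presheaf.germ_stalkSpecializes_apply hzW h b)

theorem exists_germMap_notMem_sq (x : KPoints c) {z : M.X} (h : M.j (pt x.1) ⤳ z)
    {s : Finset (M.X.presheaf.stalk z)}
    (hs : M.idealAt (M.j (pt x.1)) z = Ideal.span (s : Set (M.X.presheaf.stalk z)))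
    {u : C.presheaf.stalk (pt x.1)} (hu : u ∈ maximalIdeal (C.presheaf.stalk (pt x.1)))
    (hu_sq : u ∉ maximalIdeal (C.presheaf.stalk (pt x.1)) ^ 2) :
    ∃ a ∈ s, germMap M.j h a ∉ maximalIdeal (C.presheaf.stalk (pt x.1)) ^ 2 := by
  by_contra! h_sq
  obtain ⟨a, t, ht, h_eq⟩ := M.exists_isUnit_germMap_eq_mul h u
  have ha : a ∈ M.idealAt (M.j (pt x.1)) z := by
    have h_mem : germMap M.j h a ∈ maximalIdeal (C.presheaf.stalk (pt x.1)) :=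
      h_eq ▸ Ideal.mul_mem_right t _ hu
    exact (mem_idealAt_iff x h a).2 ((x.ev_eq_zero_iff _).2 h_mem)
  have h_le : M.idealAt (M.j (pt x.1)) z ≤
      (maximalIdeal (C.presheaf.stalk (pt x.1)) ^ 2).comap (germMap M.j h) :=
    hs ▸ Ideal.span_le.2 h_sq
  have h_mem : germMap M.j h a ∈ maximalIdeal (C.presheaf.stalk (pt x.1)) ^ 2 := h_le ha
  rw [h_eq] at h_mem
  exact hu_sq ((Ideal.mul_unit_mem_iff_mem _ ht).1 h_mem)

theorem exists_quotients (x : KPoints c) {z : M.X} (h : M.j (pt x.1) ⤳ z)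
    {s : Finset (M.X.presheaf.stalk z)}
    (hs : M.idealAt (M.j (pt x.1)) z = Ideal.span (s : Set (M.X.presheaf.stalk z)))
    {u : C.presheaf.stalk (pt x.1)} (hu_sq : u ∉ maximalIdeal (C.presheaf.stalk (pt x.1)) ^ 2)
    (h_span : maximalIdeal (C.presheaf.stalk (pt x.1)) = Ideal.span {u}) :
    ∃ q : M.X.presheaf.stalk z → C.presheaf.stalk (pt x.1),
      (∀ a ∈ s, germMap M.j h a = u * q a) ∧ ∃ a ∈ s, x.ev (q a) ≠ 0 := by
  have h_dvd : ∀ a ∈ s, ∃ e, germMap M.j h a = u * e := by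
    intro a ha
    have h_zero : x.ev (germMap M.j h a) = 0 :=
      (mem_idealAt_iff x h a).1 (hs ▸ Ideal.subset_span ha)
    rwa [x.ev_eq_zero_iff, h_span, Ideal.mem_span_singleton] at h_zero
  choose! q hq using h_dvd
  have hu : u ∈ maximalIdeal (C.presheaf.stalk (pt x.1)) := h_span ▸ Ideal.mem_span_singleton_self u
  obtain ⟨a, ha, h_sq⟩ := M.exists_germMap_notMem_sq x h hs hu hu_sq
  refine ⟨q, hq, a, ha, fun h_zero => h_sq ?_⟩
  rw [hq a ha, pow_two]
  exact Ideal.mul_mem_mul hu ((x.ev_eq_zero_iff _).1 h_zero)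

/-- The integral structure on the cotangent line at `x` is `𝔭⁻ᵏ ω`, so that `k` is the order of
`ω` with respect to it. -/
def HasCotOrder (𝔭 : HeightOneSpectrum (𝓞 K)) {x : C} (ω : Cot c x) (k : ℤ) : Prop :=
  ∀ ω', ω' ∈ M.cotLattice 𝔭 x ↔ ∃ b : K, 𝔭.valuation K b ≤ WithZero.exp k ∧ ω' = b • ω

section Quotients

variable {M} (x : KPoints c) {z : M.X} (h : M.j (pt x.1) ⤳ z) (hz : M.f z = primePt 𝔭)
  {s : Finset (M.X.presheaf.stalk z)}
  (hs : M.idealAt (M.j (pt x.1)) z = Ideal.span (s : Set (M.X.presheaf.stalk z)))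
  {u : C.presheaf.stalk (pt x.1)} {q : M.X.presheaf.stalk z → C.presheaf.stalk (pt x.1)}
  (hq : ∀ a ∈ s, germMap M.j h a = u * q a) {a₀ : M.X.presheaf.stalk z} (ha₀ : a₀ ∈ s) {k : ℤ}
  (h_val : 𝔭.valuation K (x.ev (q a₀)) = WithZero.exp k)
  (h_max : ∀ a ∈ s, 𝔭.valuation K (x.ev (q a)) ≤ 𝔭.valuation K (x.ev (q a₀)))

include hz hs hq ha₀ h_val h_max

theorem hasCotOrder_differential (hu : u ∈ maximalIdeal (C.presheaf.stalk (pt x.1))) :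
    M.HasCotOrder 𝔭 (differential c _ u) k := by
  refine fun ω => ⟨?_, ?_⟩
  · rintro ⟨z', hz', h', a, ha, rfl⟩
    obtain rfl := eq_of_j_pt_specializes x h hz h' hz'
    obtain ⟨e, he, h_le⟩ := exists_germMap_eq_mul_of_mem_span x h hz hq h_max (hs ▸ ha)
    exact ⟨x.ev e, h_val ▸ h_le, by rw [← differential_mul x hu, ← he]⟩
  · rintro ⟨b, hb, rfl⟩
    have h_ne : x.ev (q a₀) ≠ 0 := (map_ne_zero _).1 (h_val ▸ WithZero.exp_ne_zero)
    have h_le : 𝔭.valuation K (b / x.ev (q a₀)) ≤ 1 := by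
      rw [map_div₀, h_val]
      exact div_le_one_of_le₀ hb zero_le
    obtain ⟨g, hg⟩ := exists_valueAt_eq x h hz h_le
    refine ⟨z, hz, h, g * a₀, hs ▸ Ideal.mul_mem_left _ _ (Ideal.subset_span ha₀), ?_⟩
    have h_coeff : x.ev (germMap M.j h g * q a₀) = b := by
      rw [map_mul]
      exact (congrArg (· * x.ev (q a₀)) hg).trans (div_mul_cancel₀ _ h_ne)
    rw [map_mul, hq a₀ ha₀, mul_left_comm, differential_mul x hu, h_coeff]

variable {L : Type u} [NormedField L] [IsUltrametricDist L] {φ : K →+* L}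
  (hφ : ∀ a : 𝓞 K, ‖φ (algebraMap (𝓞 K) K a)‖ ≤ 1)
  (hn : ∀ a : K, ‖φ a‖ = NumberField.HeightOneSpectrum.adicAbv K 𝔭 a)

include hn

theorem tendsto_pointInt_add_log_norm (hc : SmoothOfRelativeDimension 1 c)
    (h_span : maximalIdeal (C.presheaf.stalk (pt x.1)) = Ideal.span {u}) :
    Filter.Tendsto (fun y => M.pointInt 𝔭 hφ y (M.j (pt x.1)) *
        Real.log (Ideal.absNorm 𝔭.asIdeal) + Real.log ‖stalkEval u y‖) (𝓝[≠] (x.toPoints φ))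
      (𝓝 (-(k * Real.log (Ideal.absNorm 𝔭.asIdeal)))) := by
  have h_center : M.center hφ (x.toPoints φ) = z := (M.eq_center hφ hn x h hz).symm
  have h_ne : ‖φ (x.ev (q a₀))‖₊ ≠ 0 :=
    nnnorm_ne_zero_iff.2 ((map_ne_zero φ).2 ((map_ne_zero _).1 (h_val ▸ WithZero.exp_ne_zero)))
  have h_mul : ∀ᶠ y in 𝓝 (x.toPoints φ), ∀ a ∈ s,
      stalkEval (germMap M.j h a) y = stalkEval u y * stalkEval (q a) y := by
    refine (Filter.eventually_all_finset s).2 fun a ha => ?_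
    rw [hq a ha]
    exact eventually_stalkEval_mul (pt_toPoints x φ) u (q a)
  refine ((tendsto_log_sup_nnnorm_stalkEval hn x ha₀ h_max h_val).neg.mono_left
    nhdsWithin_le_nhds).congr' ?_
  filter_upwards [eventually_stalkEval_ne_zero hc x h_span (φ := φ),
    nhdsWithin_le_nhds (M.eventually_pointInt_eq 𝔭 hφ x h_center h (M.j (pt x.1)) s hs),
    nhdsWithin_le_nhds h_mul, nhdsWithin_le_nhds
      ((tendsto_sup_nnnorm_stalkEval hn x ha₀ h_max).eventually_ne h_ne)]
    with y hu_ne h_int hy_mul h_sup_ne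
  have h_sup : (s.sup fun a => ‖stalkEval (germMap M.j h a) y‖₊) =
      ‖stalkEval u y‖₊ * s.sup fun a => ‖stalkEval (q a) y‖₊ := by
    rw [NNReal.mul_finset_sup]
    exact Finset.sup_congr rfl fun a ha => by rw [hy_mul a ha, nnnorm_mul]
  rw [h_int, h_sup, NNReal.coe_mul, coe_nnnorm, Real.log_mul (norm_ne_zero_iff.2 hu_ne)
    (NNReal.coe_ne_zero.2 h_sup_ne), div_mul_cancel₀ _ (log_absNorm_pos 𝔭).ne']
  ring

end Quotients

theorem exists_hasCotOrder_and_tendsto (hc : SmoothOfRelativeDimension 1 c)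
    {L : Type u} [NormedField L] [IsUltrametricDist L] {φ : K →+* L}
    (hφ : ∀ a : 𝓞 K, ‖φ (algebraMap (𝓞 K) K a)‖ ≤ 1)
    (hn : ∀ a : K, ‖φ a‖ = NumberField.HeightOneSpectrum.adicAbv K 𝔭 a) (x : KPoints c)
    {u : C.presheaf.stalk (pt x.1)} (hu : u ∈ maximalIdeal (C.presheaf.stalk (pt x.1)))
    (hu_sq : u ∉ maximalIdeal (C.presheaf.stalk (pt x.1)) ^ 2) :
    ∃ k : ℤ, M.HasCotOrder 𝔭 (differential c _ u) k ∧
      Filter.Tendsto (fun y => M.pointInt 𝔭 hφ y (M.j (pt x.1)) *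
        Real.log (Ideal.absNorm 𝔭.asIdeal) + Real.log ‖stalkEval u y‖) (𝓝[≠] (x.toPoints φ))
        (𝓝 (-(k * Real.log (Ideal.absNorm 𝔭.asIdeal)))) := by
  have h_span := maximalIdeal_eq_span_of_notMem_sq
    (isPrincipal_maximalIdeal_of_smooth hc x) hu hu_sq
  obtain ⟨z, h, hz⟩ : ∃ z, M.j (pt x.1) ⤳ z ∧ M.f z = primePt 𝔭 :=
    ⟨M.center hφ (x.toPoints φ), by
      simpa only [pt_toPoints] using M.j_specializes_center hφ (x.toPoints φ),
      M.f_center hφ hn _⟩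
  obtain ⟨s, hs⟩ := M.exists_finset_span (M.j (pt x.1)) z
  obtain ⟨q, hq, h_ne⟩ := M.exists_quotients x h hs hu_sq h_span
  obtain ⟨a₀, ha₀, h_ne₀, h_max⟩ := exists_ne_zero_forall_valuation_le (𝔭.valuation K) h_ne
  have h_val := (WithZero.exp_log ((map_ne_zero (𝔭.valuation K)).2 h_ne₀)).symm
  exact ⟨_, hasCotOrder_differential x h hz hs hq ha₀ h_val h_max hu,
    tendsto_pointInt_add_log_norm x h hz hs hq ha₀ h_val h_max hφ hn hc h_span⟩

end RegularModel

theorem exists_valuation_eq_exp {R : Type*} [CommRing R] [IsDedekindDomain R] (K : Type*) [Field K]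
    [Algebra R K] [IsFractionRing R K] (𝔭 : HeightOneSpectrum R) (n : ℤ) :
    ∃ a : K, 𝔭.valuation K a = WithZero.exp n := by
  obtain ⟨ϖ, hϖ⟩ := 𝔭.valuation_exists_uniformizer K
  refine ⟨ϖ ^ (-n), ?_⟩
  rw [map_zpow₀, hϖ]
  change WithZero.exp (-1 : ℤ) ^ (-n) = _
  rw [← WithZero.exp_zsmul, smul_eq_mul, neg_mul_neg, mul_one]

namespace RegularModel

variable {K : Type u} [Field K] [NumberField K] {C : Scheme.{u}} {c : C ⟶ Spec (.of K)}
  {M : RegularModel c} {𝔭 : HeightOneSpectrum (𝓞 K)} {x y : C} {ω : Cot c x} {η : Cot c y}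
  {k l : ℤ} (hω : M.HasCotOrder 𝔭 ω k) (hη : M.HasCotOrder 𝔭 η l)

include hω hη

theorem exists_eq_smul_tmul_of_mem_tensorLattice {ζ : Cot c x ⊗[K] Cot c y}
    (hζ : ζ ∈ M.tensorLattice 𝔭 x y) :
    ∃ b : K, 𝔭.valuation K b ≤ WithZero.exp (k + l) ∧ ζ = b • ω ⊗ₜ[K] η := by
  induction hζ using AddSubgroup.closure_induction with
  | mem ζ hζ =>
    obtain ⟨ω', hω', η', hη', rfl⟩ := hζ
    obtain ⟨b, hb, rfl⟩ := (hω _).1 hω'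
    obtain ⟨b', hb', rfl⟩ := (hη _).1 hη'
    refine ⟨b * b', ?_, TensorProduct.smul_tmul_smul b b' ω η⟩
    rw [map_mul, WithZero.exp_add]
    exact mul_le_mul' hb hb'
  | zero => exact ⟨0, (map_zero (𝔭.valuation K)).trans_le zero_le, (zero_smul K _).symm⟩
  | add ζ ζ' _ _ hζ hζ' =>
    obtain ⟨b, hb, rfl⟩ := hζ
    obtain ⟨b', hb', rfl⟩ := hζ'
    exact ⟨b + b', (Valuation.map_add _ _ _).trans (max_le hb hb'), (add_smul b b' _).symm⟩
  | neg ζ _ hζ =>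
    obtain ⟨b, hb, rfl⟩ := hζ
    exact ⟨-b, (Valuation.map_neg _ _).trans_le hb, (neg_smul b _).symm⟩

theorem cotVal_tmul (h_ne : ω ⊗ₜ[K] η ≠ 0) : M.cotVal 𝔭 (ω ⊗ₜ[K] η) = k + l := by
  refine IsGreatest.csSup_eq ⟨?_, ?_⟩
  · obtain ⟨a, ha⟩ := exists_valuation_eq_exp K 𝔭 k
    obtain ⟨b, hb⟩ := exists_valuation_eq_exp K 𝔭 l
    have ha₀ : a ≠ 0 := (map_ne_zero (𝔭.valuation K)).1 (ha ▸ WithZero.exp_ne_zero)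
    have hb₀ : b ≠ 0 := (map_ne_zero (𝔭.valuation K)).1 (hb ▸ WithZero.exp_ne_zero)
    refine ⟨(a * b)⁻¹, ?_, (a • ω) ⊗ₜ[K] (b • η), AddSubgroup.subset_closure
      ⟨_, (hω _).2 ⟨a, ha.le, rfl⟩, _, (hη _).2 ⟨b, hb.le, rfl⟩, rfl⟩, ?_⟩
    · rw [map_inv₀, map_mul, ha, hb, ← WithZero.exp_add, WithZero.exp_neg]
    · rw [TensorProduct.smul_tmul_smul, inv_smul_smul₀ (mul_ne_zero ha₀ hb₀)]
  · rintro n ⟨a, ha, ζ, hζ, h_eq⟩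
    obtain ⟨b, hb, rfl⟩ := exists_eq_smul_tmul_of_mem_tensorLattice hω hη hζ
    have h_mul : a * b = 1 := by
      rw [smul_smul] at h_eq
      exact smul_left_injective K h_ne (h_eq.symm.trans (one_smul K _).symm)
    have h_val := congrArg (𝔭.valuation K) h_mul
    rw [map_mul, map_one, ha, WithZero.exp_neg, inv_mul_eq_one₀ WithZero.exp_ne_zero] at h_val
    rwa [← h_val, WithZero.exp_le_exp] at hb

end RegularModel

section PrimePt

variable {K : Type u} [Field K] [NumberField K]

theorem eq_of_primePt_specializes {𝔮 : HeightOneSpectrum (𝓞 K)} {y : Spec (.of (𝓞 K))}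
    (h : primePt 𝔮 ⤳ y) : y = primePt 𝔮 := by
  have h_le : (⟨𝔮.asIdeal, 𝔮.isPrime⟩ : PrimeSpectrum (𝓞 K)) ≤ y :=
    (PrimeSpectrum.le_iff_specializes _ _).2 h
  exact (PrimeSpectrum.ext (𝔮.isMaximal.eq_of_le y.isPrime.ne_top h_le)).symm

theorem primePt_injective : Function.Injective (primePt (K := K)) := fun _ _ h =>
  HeightOneSpectrum.ext (congrArg PrimeSpectrum.asIdeal h)

theorem eq_genericPt_or_exists_eq_primePt (y : Spec (.of (𝓞 K))) :
    y = genericPt K ∨ ∃ 𝔮, y = primePt 𝔮 := by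
  by_cases h : PrimeSpectrum.asIdeal y = ⊥
  · exact Or.inl (PrimeSpectrum.ext (h.trans genericPt_asIdeal.symm))
  · exact Or.inr ⟨⟨PrimeSpectrum.asIdeal y, PrimeSpectrum.isPrime y, h⟩, rfl⟩

omit [NumberField K] in
theorem genericPt_specializes (y : Spec (.of (𝓞 K))) : genericPt K ⤳ y := by
  have h_le : PrimeSpectrum.asIdeal (genericPt K) ≤ PrimeSpectrum.asIdeal y :=
    genericPt_asIdeal.trans_le bot_le
  exact (PrimeSpectrum.le_iff_specializes _ _).1 h_le

end PrimePt

theorem sum_sum_erase_eq_zero {ι A : Type*} [DecidableEq ι] [AddCommGroup A] [IsAddTorsionFree A]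
    (T : Finset ι) {g : ι → ι → A} (hg : ∀ i j, g j i = -g i j) :
    ∑ i ∈ T, ∑ j ∈ T.erase i, g i j = 0 := by
  have h_comm : ∑ i ∈ T, ∑ j ∈ T.erase i, g i j = ∑ j ∈ T, ∑ i ∈ T.erase j, g i j :=
    Finset.sum_comm' fun i j => by simp only [Finset.mem_erase]; tauto
  refine self_eq_neg.1 (h_comm.trans ?_)
  simp only [← Finset.sum_neg_distrib, ← hg]

namespace RegularModel

variable {K : Type u} [Field K] [NumberField K] {C : Scheme.{u}} {c : C ⟶ Spec (.of K)}
  (M : RegularModel c) {𝔭 : HeightOneSpectrum (𝓞 K)}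

theorem f_genericPoint : haveI := M.isIntegral; M.f (genericPoint M.X) = genericPt K := by
  have := M.isIntegral
  have := M.flat
  obtain ⟨y, hy, hfy⟩ := Flat.generalizingMap M.f (genericPt_specializes (M.f (genericPoint M.X)))
  rwa [(genericPoint_specializes y).antisymm hy |>.eq]

theorem not_specializes_of_f_eq_genericPt {𝔮 : HeightOneSpectrum (𝓞 K)} {w y : M.X}
    (hw : M.f w = primePt 𝔮) (hy : M.f y = genericPt K) : ¬ w ⤳ y := by
  intro h
  have h_map := h.map M.f.continuous
  rw [hw, hy] at h_map
  exact primePt_ne_genericPt 𝔮 (eq_of_primePt_specializes h_map).symm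

theorem not_specializes_j {𝔮 : HeightOneSpectrum (𝓞 K)} {w : M.X} (hw : M.f w = primePt 𝔮)
    (x : C) : ¬ w ⤳ M.j x :=
  M.not_specializes_of_f_eq_genericPt hw (M.f_j x)

theorem intNum_eq_zero_of_ne {𝔮 : HeightOneSpectrum (𝓞 K)} {w : M.X} (hw : M.f w = primePt 𝔮)
    (h : 𝔮 ≠ 𝔭) (y : M.X) : M.intNum 𝔭 w y = 0 := by
  refine finsum_mem_eq_zero_of_forall_eq_zero fun z (hz : M.f z = primePt 𝔭) => ?_
  rw [M.localInt_eq_zero, Nat.cast_zero, zero_mul]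
  intro hwz
  have h_map := hwz.map M.f.continuous
  rw [hw, hz] at h_map
  exact h (primePt_injective (eq_of_primePt_specializes h_map).symm)

theorem noetherianSpace : TopologicalSpace.NoetherianSpace M.X := by
  have := M.isProper
  have : IsNoetherianRing (𝓞 K) := inferInstance
  have : IsLocallyNoetherian M.X := LocallyOfFiniteType.isLocallyNoetherian M.f
  have : CompactSpace M.X := QuasiCompact.compactSpace_of_compactSpace M.f
  have : IsNoetherian M.X := {}
  infer_instance

theorem eq_of_specializes_component {V V' : M.X} (hV : V ∈ M.components 𝔭)
    (hV' : M.f V' = primePt 𝔭) (h : V' ⤳ V) : V' = V := by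
  have := M.isIntegral
  by_contra h_ne
  have h_lt : V < V' := lt_of_le_not_ge h fun h' => h_ne (h.antisymm h').eq
  have h_coheight : Order.coheight V' = 0 := by
    have h_add := Order.coheight_add_one_le h_lt
    rw [hV.1] at h_add
    exact nonpos_iff_eq_zero.1 <|
      (ENat.add_le_add_iff_right ENat.one_ne_top).1 (h_add.trans_eq (zero_add 1).symm)
  rw [Order.coheight_eq_zero] at h_coheight
  exact M.not_specializes_of_f_eq_genericPt hV' M.f_genericPoint
    (h_coheight (genericPoint_specializes V'))

variable (𝔭) in
theorem finite_components : (M.components 𝔭).Finite := by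
  have := M.isIntegral
  have := M.noetherianSpace
  have h_closed : IsClosed {primePt 𝔭} :=
    (PrimeSpectrum.isClosed_singleton_iff_isMaximal
      (⟨𝔭.asIdeal, 𝔭.isPrime⟩ : PrimeSpectrum (𝓞 K))).2 𝔭.isMaximal
  obtain ⟨S, h_fin, hS_closed, hS_irred, h_union⟩ :=
    TopologicalSpace.NoetherianSpace.exists_finite_set_isClosed_irreducible
      (h_closed.preimage M.f.continuous)
  have h_gen : ∀ t ∈ S, ∃ g : M.X, closure {g} = t := fun t ht =>
    ⟨(hS_irred t ht).genericPoint, (hS_irred t ht).closure_genericPoint (hS_closed t ht)⟩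
  choose! g hg using h_gen
  refine (h_fin.image g).subset fun V hV => ?_
  obtain ⟨t, ht, hVt⟩ : V ∈ ⋃₀ S := h_union ▸ hV.2
  refine ⟨t, ht, M.eq_of_specializes_component hV ?_ ?_⟩
  · have h_mem : g t ∈ ⋃₀ S := ⟨t, ht, (hg t ht).subset (subset_closure rfl)⟩
    rwa [← h_union] at h_mem
  · rw [specializes_iff_mem_closure, hg t ht]
    exact hVt

theorem fiberCoeff_of_notMem {w : M.X} (h : w ∉ M.components 𝔭) : M.fiberCoeff 𝔭 w = 0 :=
  if_neg h

theorem finite_support_degreeOn (D : M.X →₀ ℚ) (V : M.X) :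
    (Function.support fun w =>
      (D w - D V / M.fiberCoeff 𝔭 V * M.fiberCoeff 𝔭 w) * M.intNum 𝔭 w V).Finite := by
  refine ((M.finite_components 𝔭).union D.support.finite_toSet).subset fun w hw => ?_
  by_contra h_notMem
  rw [Set.mem_union, not_or, Finset.mem_coe, Finsupp.notMem_support_iff] at h_notMem
  refine hw ?_
  beta_reduce
  rw [h_notMem.2, M.fiberCoeff_of_notMem h_notMem.1, mul_zero, sub_zero, zero_mul]

theorem degreeOn_add (D D' : M.X →₀ ℚ) (V : M.X) :
    M.degreeOn 𝔭 (D + D') V = M.degreeOn 𝔭 D V + M.degreeOn 𝔭 D' V := by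
  rw [degreeOn, degreeOn, degreeOn, ← finsum_mem_add_distrib'
    ((M.finite_support_degreeOn D V).inter_of_right _)
    ((M.finite_support_degreeOn D' V).inter_of_right _)]
  refine finsum_mem_congr rfl fun w _ => ?_
  rw [Finsupp.add_apply, Finsupp.add_apply]
  ring

theorem degreeOn_sub (D D' : M.X →₀ ℚ) (V : M.X) :
    M.degreeOn 𝔭 (D - D') V = M.degreeOn 𝔭 D V - M.degreeOn 𝔭 D' V := by
  rw [eq_sub_iff_add_eq, ← degreeOn_add, sub_add_cancel]

theorem degreeOn_closureDiv (x : KPoints c) {V : M.X} (hV : V ∈ M.components 𝔭) :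
    M.degreeOn 𝔭 (M.closureDiv x) V = M.intNum 𝔭 (M.j (pt x.1)) V := by
  have h_ne : M.j (pt x.1) ≠ V := by
    rintro rfl
    exact M.not_specializes_j hV.2 _ specializes_rfl
  have h_zero : ∀ w ≠ M.j (pt x.1), M.closureDiv x w = 0 := fun w => Finsupp.single_eq_of_ne
  have h_one : M.closureDiv x (M.j (pt x.1)) = 1 := Finsupp.single_eq_same
  simp only [degreeOn, h_zero V h_ne.symm, zero_div, zero_mul, sub_zero]
  rw [finsum_mem_eq_sum_of_inter_support_eq (t := {M.j (pt x.1)}), Finset.sum_singleton, h_one,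
    one_mul]
  ext w
  simp only [Set.mem_inter_iff, Function.mem_support, Finset.coe_singleton, Set.mem_singleton_iff]
  refine and_congr_left fun hw => ⟨fun _ => by_contra fun h => hw ?_, fun h => h ▸ h_ne⟩
  rw [h_zero w h, zero_mul]

theorem intersection_closureDiv (x : KPoints c) (D : M.X →₀ ℚ) :
    M.intersection 𝔭 (M.closureDiv x) D =
      Finsupp.linearCombination ℚ (M.intNum 𝔭 (M.j (pt x.1))) D := by
  rw [intersection, closureDiv, Finsupp.sum_single_index
    (by simp only [zero_mul, Finsupp.sum_fun_zero]), Finsupp.linearCombination_apply]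
  simp only [one_mul, smul_eq_mul]
  rfl

theorem intersection_closureDiv_closureDiv (x y : KPoints c) :
    M.intersection 𝔭 (M.closureDiv x) (M.closureDiv y) =
      M.intNum 𝔭 (M.j (pt x.1)) (M.j (pt y.1)) := by
  rw [intersection_closureDiv, closureDiv, Finsupp.linearCombination_single, one_smul]
  rfl

theorem intersection_closureDiv_comm (x y : KPoints c) :
    M.intersection 𝔭 (M.closureDiv x) (M.closureDiv y) =
      M.intersection 𝔭 (M.closureDiv y) (M.closureDiv x) := by
  rw [intersection_closureDiv_closureDiv, intersection_closureDiv_closureDiv, intNum_comm]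

theorem intersection_closureDiv_neg (x : KPoints c) (D : M.X →₀ ℚ) :
    M.intersection 𝔭 (M.closureDiv x) (-D) = -M.intersection 𝔭 (M.closureDiv x) D := by
  rw [intersection_closureDiv, intersection_closureDiv, map_neg]

theorem intersection_closureDiv_sub (x y : KPoints c) (D : M.X →₀ ℚ) :
    M.intersection 𝔭 (M.closureDiv x - M.closureDiv y) D =
      M.intersection 𝔭 (M.closureDiv x) D - M.intersection 𝔭 (M.closureDiv y) D := by
  rw [intersection, Finsupp.sum_sub_index]
  · rfl
  · intro w b b'
    rw [← Finsupp.sum_sub]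
    exact Finsupp.sum_congr fun _ _ => by ring

variable {M}

theorem HasDegreeZero.intNum_sub_eq {x y : KPoints c} {Θ : M.X →₀ ℚ}
    (hΘ : M.HasDegreeZero 𝔭 (M.closureDiv x - M.closureDiv y + Θ)) {V : M.X}
    (hV : V ∈ M.components 𝔭) :
    M.intNum 𝔭 (M.j (pt x.1)) V - M.intNum 𝔭 (M.j (pt y.1)) V = -M.degreeOn 𝔭 Θ V := by
  rw [eq_neg_iff_add_eq_zero, ← M.degreeOn_closureDiv x hV, ← M.degreeOn_closureDiv y hV,
    ← degreeOn_sub, ← degreeOn_add]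
  exact hΘ V hV

namespace IsVertical

theorem mem_components {D : M.X →₀ ℚ} (hD : M.IsVertical D) {w y : M.X} (hw : D w ≠ 0)
    (h : M.intNum 𝔭 w y ≠ 0) : w ∈ M.components 𝔭 := by
  have h_supp : w ∈ D.support := Finsupp.mem_support_iff.2 hw
  obtain ⟨𝔮, h𝔮⟩ := hD.2 w h_supp
  obtain rfl : 𝔮 = 𝔭 := by_contra fun h_ne => h (M.intNum_eq_zero_of_ne h𝔮 h_ne y)
  exact ⟨hD.1 w h_supp, h𝔮⟩

open Classical in
theorem degreeOn_eq_sum {D : M.X →₀ ℚ} (hD : M.IsVertical D) (V : M.X) :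
    M.degreeOn 𝔭 D V = ∑ w ∈ (M.finite_components 𝔭).toFinset.erase V,
      (D w - D V / M.fiberCoeff 𝔭 V * M.fiberCoeff 𝔭 w) * M.intNum 𝔭 w V := by
  refine finsum_mem_eq_sum_of_inter_support_eq _ ?_
  ext w
  simp only [Set.mem_inter_iff, Function.mem_support, Finset.coe_erase, Set.mem_sdiff,
    Set.Finite.coe_toFinset, Set.mem_singleton_iff]
  refine and_congr_left fun hw => ⟨fun h => ⟨by_contra fun h_notMem => ?_, h⟩, fun h => h.2⟩
  rw [M.fiberCoeff_of_notMem h_notMem, mul_zero, sub_zero] at hw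
  exact h_notMem (hD.mem_components (left_ne_zero_of_mul hw) (right_ne_zero_of_mul hw))

theorem sum_mul_degreeOn_comm {D E : M.X →₀ ℚ} (hD : M.IsVertical D) (hE : M.IsVertical E) :
    ∑ V ∈ (M.finite_components 𝔭).toFinset, D V * M.degreeOn 𝔭 E V =
      ∑ V ∈ (M.finite_components 𝔭).toFinset, E V * M.degreeOn 𝔭 D V := by
  classical
  rw [← sub_eq_zero, ← Finset.sum_sub_distrib]
  simp only [hD.degreeOn_eq_sum, hE.degreeOn_eq_sum, Finset.mul_sum, ← Finset.sum_sub_distrib]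
  set T := (M.finite_components 𝔭).toFinset
  calc _ = ∑ V ∈ T, ∑ w ∈ T.erase V, (D V * E w - E V * D w) * M.intNum 𝔭 w V :=
        Finset.sum_congr rfl fun V _ => Finset.sum_congr rfl fun w _ => by ring
    _ = 0 := sum_sum_erase_eq_zero T fun V w => by rw [M.intNum_comm 𝔭 V w]; ring

theorem intersection_closureDiv_eq_sum {D : M.X →₀ ℚ} (hD : M.IsVertical D) (x : KPoints c) :
    M.intersection 𝔭 (M.closureDiv x) D =
      ∑ V ∈ (M.finite_components 𝔭).toFinset, D V * M.intNum 𝔭 (M.j (pt x.1)) V := by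
  classical
  rw [intersection_closureDiv, Finsupp.linearCombination_apply]
  refine Finset.sum_congr_of_eq_on_inter (fun V hV hVT => ?_) (fun V _ hVD => ?_) fun _ _ _ => rfl
  · rw [Set.Finite.mem_toFinset] at hVT
    beta_reduce
    rw [M.intNum_comm, smul_eq_mul, mul_eq_zero, or_iff_not_imp_right]
    exact fun h_ne => absurd (hD.mem_components (Finsupp.mem_support_iff.1 hV) h_ne) hVT
  · rw [Finsupp.notMem_support_iff.1 hVD, zero_mul]

theorem intersection_closureDiv_sub_eq_neg_sum {x y : KPoints c} {Φ Ψ : M.X →₀ ℚ}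
    (hΦ : M.IsVertical Φ)
    (hΨ : M.HasDegreeZero 𝔭 (M.closureDiv x - M.closureDiv y + Ψ)) :
    M.intersection 𝔭 (M.closureDiv x - M.closureDiv y) Φ =
      -∑ V ∈ (M.finite_components 𝔭).toFinset, Φ V * M.degreeOn 𝔭 Ψ V := by
  rw [intersection_closureDiv_sub, hΦ.intersection_closureDiv_eq_sum,
    hΦ.intersection_closureDiv_eq_sum, ← Finset.sum_sub_distrib, ← Finset.sum_neg_distrib]
  refine Finset.sum_congr rfl fun V hV => ?_
  rw [← mul_sub, hΨ.intNum_sub_eq ((Set.Finite.mem_toFinset _).1 hV), mul_neg]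

theorem intersection_closureDiv_sub_congr {x y : KPoints c} {Φ Ψ : M.X →₀ ℚ}
    (hΦ : M.IsVertical Φ) (hΨ : M.IsVertical Ψ)
    (hΦ_deg : M.HasDegreeZero 𝔭 (M.closureDiv x - M.closureDiv y + Φ))
    (hΨ_deg : M.HasDegreeZero 𝔭 (M.closureDiv x - M.closureDiv y + Ψ)) :
    M.intersection 𝔭 (M.closureDiv x - M.closureDiv y) Φ =
      M.intersection 𝔭 (M.closureDiv x - M.closureDiv y) Ψ := by
  rw [hΦ.intersection_closureDiv_sub_eq_neg_sum hΨ_deg,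
    hΨ.intersection_closureDiv_sub_eq_neg_sum hΦ_deg, hΦ.sum_mul_degreeOn_comm hΨ]

end IsVertical

end RegularModel

namespace RegularModel

section Admissible

variable {K : Type u} [Field K] [NumberField K] {C : Scheme.{u}} {c : C ⟶ Spec (.of K)}
  (M : RegularModel c) {𝔭 : HeightOneSpectrum (𝓞 K)} {p q : KPoints c}

theorem j_injective : Function.Injective M.j := M.isPreimmersion_j.isEmbedding.injective

variable {M} in
theorem IsVertical.neg {Φ : M.X →₀ ℚ} (hΦ : M.IsVertical Φ) : M.IsVertical (-Φ) := by
  rwa [IsVertical, IsDivisor, Finsupp.support_neg]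

variable {M} in
theorem IsVertical.apply_j {Φ : M.X →₀ ℚ} (hΦ : M.IsVertical Φ) (x : C) : Φ (M.j x) = 0 := by
  by_contra h
  obtain ⟨𝔮, h𝔮⟩ := hΦ.2 _ (Finsupp.mem_support_iff.2 h)
  exact M.not_specializes_j h𝔮 x specializes_rfl

theorem closureDiv_sub_apply_j (x : C) :
    (M.closureDiv p - M.closureDiv q) (M.j x) = pointDiff p q x := by
  classical
  simp only [pointDiff, closureDiv, closurePt, Finsupp.sub_apply, Finsupp.single_apply,
    M.j_injective.eq_iff]
  push_cast
  rfl

theorem closureDiv_apply_of_notMem_range {w : M.X} (hw : w ∉ Set.range M.j) :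
    M.closureDiv p w = 0 :=
  Finsupp.single_eq_of_ne fun h => hw ⟨_, h.symm⟩

theorem isAdmissible_closureDiv_sub_add (hc : SmoothOfRelativeDimension 1 c)
    (hpq : pt p.1 ≠ pt q.1) {Φ : M.X →₀ ℚ} (hΦ : M.IsVertical Φ)
    (hΦ_deg : M.HasDegreeZero 𝔭 (M.closureDiv p - M.closureDiv q + Φ)) :
    M.IsAdmissible 𝔭 (pointDiff p q) (M.closureDiv p - M.closureDiv q + Φ) := by
  refine ⟨fun y hy => ?_, fun x => ?_, hΦ_deg⟩
  · by_cases hyp : y = M.j (pt p.1)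
    · exact hyp ▸ M.coheight_j_eq_one hc hpq
    by_cases hyq : y = M.j (pt q.1)
    · exact hyq ▸ M.coheight_j_eq_one hc hpq.symm
    have hp_zero : M.closureDiv p y = 0 := Finsupp.single_eq_of_ne hyp
    have hq_zero : M.closureDiv q y = 0 := Finsupp.single_eq_of_ne hyq
    refine hΦ.1 y (Finsupp.mem_support_iff.2 ?_)
    rwa [Finsupp.mem_support_iff, Finsupp.add_apply, Finsupp.sub_apply, hp_zero, hq_zero, sub_zero,
      zero_add] at hy
  · rw [Finsupp.add_apply]
    exact (congrArg₂ (· + ·) (M.closureDiv_sub_apply_j x) (hΦ.apply_j x)).trans (add_zero _)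

variable {M} in
theorem IsAdmissible.isVertical_sub {𝓔 : M.X →₀ ℚ} (h : M.IsAdmissible 𝔭 (pointDiff p q) 𝓔) :
    M.IsVertical (𝓔 - (M.closureDiv p - M.closureDiv q)) := by
  have h_range : ∀ w ∈ (𝓔 - (M.closureDiv p - M.closureDiv q)).support,
      w ∉ Set.range M.j := by
    rintro _ hw ⟨x, rfl⟩
    refine Finsupp.mem_support_iff.1 hw ?_
    rw [Finsupp.sub_apply, M.closureDiv_sub_apply_j]
    exact sub_eq_zero.2 (h.2.1 x)
  refine ⟨fun w hw => h.1 w ?_, fun w hw => ?_⟩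
  · have hw_range := h_range w hw
    rw [Finsupp.mem_support_iff] at hw ⊢
    rwa [Finsupp.sub_apply, Finsupp.sub_apply, M.closureDiv_apply_of_notMem_range hw_range,
      M.closureDiv_apply_of_notMem_range hw_range, sub_zero, sub_zero] at hw
  · exact (eq_genericPt_or_exists_eq_primePt (M.f w)).resolve_left
      fun h_gen => h_range w hw ((M.mem_range_j_iff w).2 h_gen)

end Admissible

section PointDivInt

variable {K : Type u} [Field K] [NumberField K] {C : Scheme.{u}} {c : C ⟶ Spec (.of K)}
  (M : RegularModel c) (𝔭 : HeightOneSpectrum (𝓞 K)) {L : Type u} [NormedField L]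
  [IsUltrametricDist L] {φ : K →+* L} (hφ : ∀ a : 𝓞 K, ‖φ (algebraMap (𝓞 K) K a)‖ ≤ 1)

/-- The intersection multiplicity `ι_𝔭(x̄, 𝓔)` of an `L`-valued point with a `ℚ`-divisor on the
model, extended linearly from prime divisors. -/
def pointDivInt (x : Points c φ) : (M.X →₀ ℚ) →ₗ[ℚ] ℝ :=
  Finsupp.linearCombination ℚ (M.pointInt 𝔭 hφ x)

theorem pointDivInt_closureDiv (x : Points c φ) (y : KPoints c) :
    M.pointDivInt 𝔭 hφ x (M.closureDiv y) = M.pointInt 𝔭 hφ x (M.j (pt y.1)) := by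
  rw [pointDivInt, closureDiv, Finsupp.linearCombination_single, one_smul]
  rfl

theorem exists_neronPairing_single_sub_single_eq {E : C →₀ ℤ} (h : ∃ 𝓔, M.IsAdmissible 𝔭 E 𝓔) :
    ∃ 𝓔, M.IsAdmissible 𝔭 E 𝓔 ∧ ∀ x y : Points c φ,
      M.neronPairing 𝔭 hφ (Finsupp.single x 1 - Finsupp.single y 1) E =
        (M.pointDivInt 𝔭 hφ y 𝓔 - M.pointDivInt 𝔭 hφ x 𝓔) *
          Real.log (Ideal.absNorm 𝔭.asIdeal) := by
  refine ⟨h.choose, h.choose_spec, fun x y => ?_⟩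
  rw [neronPairing, dif_pos h]
  have h_pairing : (Finsupp.single x (1 : ℤ) - Finsupp.single y 1).sum (fun x a =>
      h.choose.sum fun w b => a * b * M.pointInt 𝔭 hφ x w) =
      M.pointDivInt 𝔭 hφ x h.choose - M.pointDivInt 𝔭 hφ y h.choose := by
    simp only [pointDivInt, Finsupp.linearCombination_apply, mul_assoc, ← Finsupp.mul_sum,
      ← Rat.smul_def]
    rw [Finsupp.sum_sub_index fun _ _ _ => by push_cast; ring, Finsupp.sum_single_index (by simp),
      Finsupp.sum_single_index (by simp)]
    simp only [Int.cast_one, one_mul]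
  rw [h_pairing, neg_sub]

theorem exists_isVertical_and_neronPairing_eq (hc : SmoothOfRelativeDimension 1 c)
    {p q : KPoints c} (hpq : pt p.1 ≠ pt q.1) {Φ : M.X →₀ ℚ} (hΦ : M.IsVertical Φ)
    (hΦ_deg : M.HasDegreeZero 𝔭 (M.closureDiv p - M.closureDiv q + Φ)) :
    ∃ Ψ, M.IsVertical Ψ ∧ M.HasDegreeZero 𝔭 (M.closureDiv p - M.closureDiv q + Ψ) ∧
      ∀ x y : Points c φ,
        M.neronPairing 𝔭 hφ (Finsupp.single x 1 - Finsupp.single y 1) (pointDiff p q) =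
          -(M.pointDivInt 𝔭 hφ x (M.closureDiv p - M.closureDiv q + Ψ) +
            M.pointDivInt 𝔭 hφ y (M.closureDiv q - M.closureDiv p + -Ψ)) *
              Real.log (Ideal.absNorm 𝔭.asIdeal) := by
  obtain ⟨𝓔, h𝓔, h_pairing⟩ := M.exists_neronPairing_single_sub_single_eq 𝔭 hφ
    ⟨_, M.isAdmissible_closureDiv_sub_add hc hpq hΦ hΦ_deg⟩
  refine ⟨𝓔 - (M.closureDiv p - M.closureDiv q), h𝓔.isVertical_sub, ?_, fun x y => ?_⟩
  · rw [add_sub_cancel]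
    exact h𝓔.2.2
  · have h_neg : M.closureDiv q - M.closureDiv p + -(𝓔 - (M.closureDiv p - M.closureDiv q)) =
        -𝓔 := by abel
    rw [h_pairing, add_sub_cancel, h_neg, map_neg]
    ring

variable {𝔭} (hn : ∀ a : K, ‖φ a‖ = NumberField.HeightOneSpectrum.adicAbv K 𝔭 a)
include hn

variable {M} in
theorem IsVertical.tendsto_pointDivInt {Ψ : M.X →₀ ℚ} (hΨ : M.IsVertical Ψ) (x : KPoints c) :
    Filter.Tendsto (fun y => M.pointDivInt 𝔭 hφ y Ψ) (𝓝 (x.toPoints φ))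
      (𝓝 (M.intersection 𝔭 (M.closureDiv x) Ψ : ℝ)) := by
  rw [intersection_closureDiv, Finsupp.linearCombination_apply, Finsupp.sum, Rat.cast_sum]
  refine tendsto_finsetSum _ fun w hw => ?_
  obtain ⟨𝔮, h𝔮⟩ := hΨ.2 w hw
  simp only [LinearMap.coe_smulRight, LinearMap.id_coe, id_eq, Rat.smul_def, smul_eq_mul,
    Rat.cast_mul]
  exact (M.tendsto_pointInt hφ hn x (M.not_specializes_j h𝔮 _)).const_mul _

theorem exists_hasCotOrder_and_tendsto_pointDivInt (hc : SmoothOfRelativeDimension 1 c)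
    {x x' : KPoints c} (hx : pt x.1 ≠ pt x'.1) {Ψ : M.X →₀ ℚ} (hΨ : M.IsVertical Ψ)
    {u : C.presheaf.stalk (pt x.1)} (hu : u ∈ maximalIdeal (C.presheaf.stalk (pt x.1)))
    (hu_sq : u ∉ maximalIdeal (C.presheaf.stalk (pt x.1)) ^ 2) :
    ∃ k : ℤ, M.HasCotOrder 𝔭 (differential c _ u) k ∧
      Filter.Tendsto (fun y => M.pointDivInt 𝔭 hφ y (M.closureDiv x - M.closureDiv x' + Ψ) *
        Real.log (Ideal.absNorm 𝔭.asIdeal) + Real.log ‖stalkEval u y‖) (𝓝[≠] (x.toPoints φ))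
        (𝓝 ((M.intersection 𝔭 (M.closureDiv x) Ψ -
          M.intersection 𝔭 (M.closureDiv x) (M.closureDiv x') - k) *
            Real.log (Ideal.absNorm 𝔭.asIdeal))) := by
  obtain ⟨k, hk, h_self⟩ := M.exists_hasCotOrder_and_tendsto hc hφ hn x hu hu_sq
  have h_other := M.tendsto_pointInt hφ hn x (w := M.j (pt x'.1))
    fun h => hx (M.eq_of_j_specializes x' h)
  have h_vert := hΨ.tendsto_pointDivInt hφ hn x
  refine ⟨k, hk, ?_⟩
  rw [intersection_closureDiv_closureDiv]
  convert h_self.add (((h_vert.sub h_other).mono_left nhdsWithin_le_nhds).mul_const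
    (Real.log (Ideal.absNorm 𝔭.asIdeal))) using 2 with y
  · rw [map_add, map_sub, pointDivInt_closureDiv, pointDivInt_closureDiv]
    ring
  · ring

theorem exists_hasCotOrder_and_tendsto_evalAt (hc : SmoothOfRelativeDimension 1 c)
    {x x' : KPoints c} (hx : pt x.1 ≠ pt x'.1) {Ψ : M.X →₀ ℚ} (hΨ : M.IsVertical Ψ)
    {U : C.Opens} (hU : pt x.1 ∈ U) {u : Γ(C, U)} (hu : evalAt x.1 u = 0)
    (hu_ne : differential c _ ((C.presheaf.germ U _ hU).hom u) ≠ 0) :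
    (∀ᶠ y in 𝓝[≠] (x.toPoints φ), evalAt y.1 u ≠ 0) ∧
    ∃ k : ℤ, M.HasCotOrder 𝔭 (differential c _ ((C.presheaf.germ U _ hU).hom u)) k ∧
      Filter.Tendsto (fun y => M.pointDivInt 𝔭 hφ y (M.closureDiv x - M.closureDiv x' + Ψ) *
        Real.log (Ideal.absNorm 𝔭.asIdeal) + Real.log ‖evalAt y.1 u‖) (𝓝[≠] (x.toPoints φ))
        (𝓝 ((M.intersection 𝔭 (M.closureDiv x) Ψ -
          M.intersection 𝔭 (M.closureDiv x) (M.closureDiv x') - k) *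
            Real.log (Ideal.absNorm 𝔭.asIdeal))) := by
  have hu_mem : (C.presheaf.germ U _ hU).hom u ∈ maximalIdeal (C.presheaf.stalk (pt x.1)) := by
    rwa [← x.ev_eq_zero_iff, x.ev_germ]
  have hu_sq := (differential_ne_zero_iff hu_mem).1 hu_ne
  have h_span := maximalIdeal_eq_span_of_notMem_sq
    (isPrincipal_maximalIdeal_of_smooth hc x) hu_mem hu_sq
  have h_eval := (eventually_stalkEval_eq (pt_toPoints x φ) hU (g := u) rfl).filter_mono
    (nhdsWithin_le_nhds (s := {x.toPoints φ}ᶜ))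
  obtain ⟨k, hk, h_lim⟩ :=
    M.exists_hasCotOrder_and_tendsto_pointDivInt hφ hn hc hx hΨ hu_mem hu_sq
  refine ⟨?_, k, hk, h_lim.congr' ?_⟩
  · filter_upwards [h_eval, eventually_stalkEval_ne_zero hc x h_span] with y hy h_ne
    rwa [← hy]
  · filter_upwards [h_eval] with y hy
    rw [hy]

end PointDivInt

end RegularModel

theorem tmul_ne_zero_of_field {K V W : Type*} [Field K] [AddCommGroup V] [Module K V]
    [AddCommGroup W] [Module K W] {v : V} {w : W} (hv : v ≠ 0) (hw : w ≠ 0) : v ⊗ₜ[K] w ≠ 0 := by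
  intro h
  obtain ⟨f, hf⟩ := not_forall.1 ((Module.forall_dual_apply_eq_zero_iff K v).not.2 hv)
  obtain ⟨g, hg⟩ := not_forall.1 ((Module.forall_dual_apply_eq_zero_iff K w).not.2 hw)
  have h_mul := congrArg (TensorProduct.lid K K ∘ TensorProduct.map f g) h
  simp only [Function.comp_apply, TensorProduct.map_tmul, TensorProduct.lid_tmul, map_zero,
    smul_eq_mul] at h_mul
  exact mul_ne_zero hf hg h_mul

theorem NodalSmoothing.IsKodairaSpencer.ne_zero {K : Type u} [Field K] {F : NodalSmoothing K}
    {χ : Cot F.toK (pt F.zero.1)} {ξ : Cot F.c (pt F.p.1) ⊗[K] Cot F.c (pt F.q.1)}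
    (h : F.IsKodairaSpencer χ ξ) : ξ ≠ 0 := by
  obtain ⟨t, -, -, a, b, -, -, a₁, -, b₁, -, -, -, ha, hb, rfl⟩ := h
  exact tmul_ne_zero_of_field ha hb

end NeronLimit

end

open NeronLimit in
theorem theorem5_general {K : Type u} [Field K] [NumberField K] {C : Scheme.{u}}
    {c : C ⟶ Spec (.of K)} (hc : SmoothOfRelativeDimension 1 c) (M : RegularModel c)
    {p q : KPoints c} (hpq : pt p.1 ≠ pt q.1) {Φ : M.X →₀ ℚ} (hΦ : M.IsVertical Φ)
    {𝔭 : HeightOneSpectrum (𝓞 K)}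
    (hΦ_deg : M.HasDegreeZero 𝔭 (M.closureDiv p - M.closureDiv q + Φ))
    {ξ : Cot c (pt p.1) ⊗[K] Cot c (pt q.1)} (hξ : ξ ≠ 0) :
    M.IsRegularizedPairing 𝔭 p q ξ
      (((M.cotVal 𝔭 ξ : ℝ)
          + 2 * (M.intersection 𝔭 (M.closureDiv p) (M.closureDiv q) : ℝ)
          - (M.intersection 𝔭 (M.closureDiv p - M.closureDiv q) Φ : ℝ))
        * Real.log (Ideal.absNorm 𝔭.asIdeal)) := by
  rintro U V hU hV u v hu hv rfl
  obtain ⟨Ψ, hΨ, hΨ_deg, h_pairing⟩ := M.exists_isVertical_and_neronPairing_eq 𝔭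
    (norm_toCp_le_one K 𝔭) hc hpq hΦ hΦ_deg
  obtain ⟨hu_ne, k, hk, h_lim_p⟩ := M.exists_hasCotOrder_and_tendsto_evalAt
    (norm_toCp_le_one K 𝔭) (norm_toCp K 𝔭) hc hpq hΨ hU hu
    fun h => hξ (by rw [h, TensorProduct.zero_tmul])
  obtain ⟨hv_ne, l, hl, h_lim_q⟩ := M.exists_hasCotOrder_and_tendsto_evalAt
    (norm_toCp_le_one K 𝔭) (norm_toCp K 𝔭) hc hpq.symm hΨ.neg hV hv
    fun h => hξ (by rw [h, TensorProduct.tmul_zero])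
  rw [RegularModel.cotVal_tmul hk hl hξ, hΦ.intersection_closureDiv_sub_congr hΨ hΦ_deg hΨ_deg]
  convert ((h_lim_p.comp Filter.tendsto_fst).add (h_lim_q.comp Filter.tendsto_snd)).neg.congr' ?_
    using 2
  · rw [M.intersection_closureDiv_comm q p, M.intersection_closureDiv_neg q,
      M.intersection_closureDiv_sub]
    push_cast
    ring
  · filter_upwards [hu_ne.prod_mk hv_ne] with y ⟨hy_p, hy_q⟩
    simp only [Function.comp_apply]
    rw [h_pairing, norm_mul, Real.log_mul (norm_ne_zero_iff.2 hy_p) (norm_ne_zero_iff.2 hy_q)]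
    ring

open NeronLimit in
theorem theorem5 {K : Type u} [Field K] [NumberField K]
    (F : NodalSmoothing K) (M : RegularModel F.c)
    (Φ : M.X →₀ ℚ) (hΦ : M.IsVertical Φ)
    (hdeg : ∀ 𝔮 : HeightOneSpectrum (𝓞 K),
      M.HasDegreeZero 𝔮 (M.closureDiv F.p - M.closureDiv F.q + Φ))
    (χ : Cot F.toK (pt F.zero.1)) (hχ : χ ≠ 0)
    (ξ : Cot F.c (pt F.p.1) ⊗[K] Cot F.c (pt F.q.1)) (hξ : F.IsKodairaSpencer χ ξ)
    (𝔭 : HeightOneSpectrum (𝓞 K)) :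
    M.IsRegularizedPairing 𝔭 F.p F.q ξ
      (((M.cotVal 𝔭 ξ : ℝ)
          + 2 * (M.intersection 𝔭 (M.closureDiv F.p) (M.closureDiv F.q) : ℝ)
          - (M.intersection 𝔭 (M.closureDiv F.p - M.closureDiv F.q) Φ : ℝ))
        * Real.log (Ideal.absNorm 𝔭.asIdeal)) := by
  exact theorem5_general F.smooth_C M F.p_ne_q hΦ (hdeg 𝔭) hξ.ne_zero
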